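/- **Calculus.** Terms are $M ::= x \mid a \mid f(M_1,\dots,M_n)$ (variables, names, constructors). Each destructor $g$ of arity $n$ has a finite set $\mathrm{def}(g)$ of rules $g(M_1,\dots,M_n)\to M$ without names, with the variables of $M$ among those of $M_1,\dots,M_n$; $g(M'_1,\dots,M'_n)\to M'$ holds for the substitution instances of these rules. Constructors and destructors are public or private. Processes, taken up to renaming of bound names and variables, are $$P,Q ::= \overline{M}\langle N\rangle.P \mid M(x).P \mid 0 \mid P\mid Q \mid\ !P \mid (\nu a)P \mid \mathrm{let}\ x=g(M_1,\dots,M_n)\ \mathrm{in}\ P\ \mathrm{else}\ Q \mid \mathrm{if}\ M=N\ \mathrm{then}\ P\ \mathrm{else}\ Q \mid \mathtt{event}(M).P .$$ For a finite set of names $\mathrm{Init}$, an $\mathrm{Init}$-adversary is a closed process $Q$ with free names $\mathrm{fn}(Q)\subseteq\mathrm{Init}$ that contains no event and uses only public constructors and destructors. **Patterns and instrumentation.** Patterns are $p ::= x \mid a[p_1,\dots,p_n,i_1,\dots,i_m] \mid b_0[p] \mid f(p_1,\dots,p_n)$, where the $i_k$ are session identifiers (constants $\lambda$, or variables of a separate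 sort) and $b_0$ is a special symbol. The instrumented process $\mathrm{instr}(P_0)$ labels each replication with a distinct session variable $i$, and each restriction $(\nu a)$ with $a[t,s]$, where $t$ lists the variables bound above it by inputs and by applications of non-deterministic destructors (those that may give several results for the same arguments) and $s$ lists the session variables of the replications above it. The instrumented process $\mathrm{instrAdv}(Q)$ labels replications in the same way and restrictions with $b_0[a[s]]$. **Semantics.** A configuration $S,E,\mathcal P$ consists of a set $S$ of unused constant session identifiers, a mapping $E$ from names to patterns (extended to terms as a substitution, and to labels), and a finite multiset $\mathcal P$ of instrumented processes. Reductions: $0$ is erased; $!^iP$ adds a copy $P\{\lambda/i\}$ for some $\lambda\in S$, which is removed from $S$; $P\mid Q$ is split; $(\nu a:\ell)P$ becomes $P\{a'/a\}$ for some $a'\notin\mathrm{dom}(E)$, and $E$ becomes $E[a'\mapsto E(\ell)]$; $\overline{N}\langle M\rangle.Q$ and $N(x).P$ together become $Q$ and $P\{M/x\}$; $\mathrm{let}\ x=g(\vec M)\ \mathrm{in}\ P\ \mathrm{else}\ Q$ becomes $P\{M'/x\}$ if $g(\vec M)\to M'$, and $Q$ if there is no such $M'$; $\mathrm{if}\ M=N\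 \mathrm{then}\ P\ \mathrm{else}\ Q$ becomes $P$ if $M$ and $N$ are equal, and $Q$ otherwise; $\mathtt{event}(M).P$ becomes $P$. A trace is a finite sequence of reductions. It satisfies $\mathrm{message}(M,M')$ if $M'$ is sent on channel $M$ by one of its communications, $\mathrm{attacker}(M)$ if it satisfies $\mathrm{message}(c,M)$ for some $c\in\mathrm{Init}$, and $\mathrm{event}(M)$ if one of its reductions executes $\mathtt{event}(M)$. It satisfies a fact $F$, of the form $\mathrm{attacker}(p)$, $\mathrm{message}(p,p')$ or $\mathrm{event}(p)$, if it satisfies some $\alpha$ with $E'(\alpha)=F$, where $E'$ is the mapping of its last configuration. A fourth kind of facts, $\mathrm{m\text{-}event}(p)$, is used in clauses only. **Clauses.** $R_{P'_0,\mathrm{Init}}$ is the union of $[\![P'_0]\!]\rho\emptyset$, with $\rho=\{a\mapsto a[\,]\mid a\in\mathrm{fn}(P'_0)\}$, and of the attacker clauses: $\mathrm{attacker}(a[\,])$ for $a\in\mathrm{Init}$; $\mathrm{attacker}(b_0[x])$; $\mathrm{attacker}(x_1)\wedge\dots\wedge\mathrm{attacker}(x_n)\Rightarrow\mathrm{attacker}(f(x_1,\dots,x_n))$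 for public constructors $f$; $\mathrm{attacker}(M_1)\wedge\dots\wedge\mathrm{attacker}(M_n)\Rightarrow\mathrm{attacker}(M)$ for the rules $g(M_1,\dots,M_n)\to M$ of public destructors; $\mathrm{message}(x,y)\wedge\mathrm{attacker}(x)\Rightarrow\mathrm{attacker}(y)$; $\mathrm{attacker}(x)\wedge\mathrm{attacker}(y)\Rightarrow\mathrm{message}(x,y)$. The translation, up to renaming of the variables of clauses and with fresh variables $x$, $i$, is - $[\![0]\!]\rho H=\emptyset$, $\;[\![P\mid Q]\!]\rho H=[\![P]\!]\rho H\cup[\![Q]\!]\rho H$, $\;[\![!^iP]\!]\rho H=[\![P]\!](\rho[i\mapsto i])H$; - $[\![(\nu a:\ell)P]\!]\rho H=[\![P]\!](\rho[a\mapsto\rho(\ell)])H$; - $[\![M(x).P]\!]\rho H=[\![P]\!](\rho[x\mapsto x])(H\wedge\mathrm{message}(\rho(M),x))$; - $[\![\overline{M}\langle N\rangle.P]\!]\rho H=[\![P]\!]\rho H\cup\{H\Rightarrow\mathrm{message}(\rho(M),\rho(N))\}$; - $[\![\mathrm{let}\ x=g(M_1,\dots,M_n)\ \mathrm{in}\ P\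 \mathrm{else}\ Q]\!]\rho H=[\![Q]\!]\rho H\cup\bigcup[\![P]\!]((\sigma\rho)[x\mapsto\sigma'p'])(\sigma H)$, over the rules $g(p'_1,\dots,p'_n)\to p'$ in $\mathrm{def}(g)$ and a most general pair $(\sigma,\sigma')$ of substitutions with $\sigma\rho(M_j)=\sigma'p'_j$ for all $j$, if there is one; - $[\![\mathrm{if}\ M=N\ \mathrm{then}\ P\ \mathrm{else}\ Q]\!]\rho H=[\![P]\!](\sigma\rho)(\sigma H)\cup[\![Q]\!]\rho H$, with $\sigma$ a most general unifier of $\rho(M)$ and $\rho(N)$ (the first set is absent if they do not unify); - $[\![\mathtt{event}(M).P]\!]\rho H=[\![P]\!]\rho(H\wedge\mathrm{m\text{-}event}(\rho(M)))\cup\{H\Rightarrow\mathrm{event}(\rho(M))\}$. A closed fact is derivable from a set of clauses if it is the conclusion of a finite tree of closed instances of these clauses. **Theorem (Correctness of the clauses).** Let $P_0$ be a closed process, $\mathrm{Init}$ a finite set of names and $Q$ an $\mathrm{Init}$-adversary. Let $P'_0=\mathrm{instr}(P_0)$ and $Q'=\mathrm{instrAdv}(Q)$. Consider a trace $\mathcal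 T=S_0,E_0,\{P'_0,Q'\}\to^*S',E',\mathcal P'$, where $S_0$ is a countable set of constant session identifiers, $\mathrm{fn}(P'_0)\cup\mathrm{Init}\subseteq\mathrm{dom}(E_0)$ and $E_0(a)=a[\,]$ for all $a\in\mathrm{dom}(E_0)$. Let $\mathcal F_{\mathrm{me}}$ be a set of closed facts of the form $\mathrm{m\text{-}event}(p)$ such that $\mathrm{m\text{-}event}(p)\in\mathcal F_{\mathrm{me}}$ whenever $\mathcal T$ satisfies $\mathrm{event}(p)$. Then every fact satisfied by $\mathcal T$ is derivable from $R_{P'_0,\mathrm{Init}}\cup\mathcal F_{\mathrm{me}}$. -/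

import Mathlib

universe u v w x

set_option linter.checkUnivs false

namespace Corr

/-! ### Signatures, terms and rewrite rules -/

/-- A set of constructors, each with an arity, some of which are public. -/
structure CtorSig where
  Ctor : Type u
  ctorArity : Ctor → ℕ
  ctorPublic : Ctor → Prop

/-- Terms without names, over the variables `0, 1, 2, …`; they occur in rewrite rules. -/
inductive RuleTerm (C : CtorSig.{u}) : Type u where
  | var (n : ℕ) : RuleTerm C
  | app (f : C.Ctor) (args : Fin (C.ctorArity f) → RuleTerm C) : RuleTerm C

def RuleTerm.vars {C : CtorSig.{u}} : RuleTerm C → Set ℕ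
  | .var n => {n}
  | .app _ args => ⋃ j, (args j).vars

/-- A rewrite rule `g(M₁, …, Mₙ) → M` for a destructor `g` of arity `n`: the terms contain no
names and the variables of `M` occur in `M₁, …, Mₙ`. -/
structure RewriteRule (C : CtorSig.{u}) (n : ℕ) where
  lhs : Fin n → RuleTerm C
  rhs : RuleTerm C
  vars_rhs : rhs.vars ⊆ ⋃ j, (lhs j).vars

/-- Constructors and destructors; `rules g` is the finite set `def(g)`. -/
structure Signature extends CtorSig.{u} where
  Dtor : Type v
  dtorArity : Dtor → ℕ
  dtorPublic : Dtor → Prop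
  rules : (g : Dtor) → Finset (RewriteRule toCtorSig (dtorArity g))

/-- Terms of the calculus. Processes are identified up to renaming of bound names and variables,
which is rendered by de Bruijn indices: `bound k` is an occurrence of the variable or name that is
bound by the `k`-th enclosing binder (inputs, destructor applications and restrictions bind one
index each), and `name a` is a free name. -/
inductive Term (C : CtorSig.{u}) (Name : Type w) : Type (max u w) where
  | bound (k : ℕ) : Term C Name
  | name (a : Name) : Term C Name
  | app (f : C.Ctor) (args : Fin (C.ctorArity f) → Term C Name) : Term C Name

namespace Term

variable {C : CtorSig.{u}} {Name : Type w}

/-- Substitution of the closed term `M` for the index `k`. -/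
def openAt (M : Term C Name) : ℕ → Term C Name → Term C Name
  | k, .bound j => if j = k then M else .bound j
  | _, .name a => .name a
  | k, .app f args => .app f fun j => openAt M k (args j)

/-- All indices are smaller than `n`. -/
def Scoped (n : ℕ) : Term C Name → Prop
  | .bound k => k < n
  | .name _ => True
  | .app _ args => ∀ j, (args j).Scoped n

/-- Free names. -/
def fn : Term C Name → Set Name
  | .bound _ => ∅
  | .name a => {a}
  | .app _ args => ⋃ j, (args j).fn

/-- Only public constructors are used. -/
def PublicOnly : Term C Name → Prop
  | .bound _ => True
  | .name _ => True
  | .app f args => C.ctorPublic f ∧ ∀ j, (args j).PublicOnly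

end Term

/-- Application of a substitution to a term of a rewrite rule, with terms as results. -/
def RuleTerm.toTerm {C : CtorSig.{u}} {Name : Type w} (σ : ℕ → Term C Name) :
    RuleTerm C → Term C Name
  | .var n => σ n
  | .app f args => .app f fun j => (args j).toTerm σ

/-- `g(M₁, …, Mₙ) → M'`: an instance of a rule in `def(g)`. -/
def Reduces (Sg : Signature.{u, v}) {Name : Type w} (g : Sg.Dtor)
    (Ms : Fin (Sg.dtorArity g) → Term Sg.toCtorSig Name) (M' : Term Sg.toCtorSig Name) : Prop :=
  ∃ r ∈ Sg.rules g, ∃ σ : ℕ → Term Sg.toCtorSig Name,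
    (∀ j, Ms j = (r.lhs j).toTerm σ) ∧ M' = r.rhs.toTerm σ

/-- A destructor that may return several different results for the same arguments. -/
def NonDeterministic (Sg : Signature.{u, v}) (Name : Type w) (g : Sg.Dtor) : Prop :=
  ∃ (Ms : Fin (Sg.dtorArity g) → Term Sg.toCtorSig Name) (M₁ M₂ : Term Sg.toCtorSig Name),
    Reduces Sg g Ms M₁ ∧ Reduces Sg g Ms M₂ ∧ M₁ ≠ M₂

/-! ### Processes -/

/-- Processes. The name `a` in `res a P` is the name chosen for the bound name; it serves as name
function symbol in the instrumentation, while its occurrences in `P` are indices. -/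
inductive Proc (Sg : Signature.{u, v}) (Name : Type w) : Type (max u v w) where
  /-- output of `N` on the channel `M` -/
  | output (M N : Term Sg.toCtorSig Name) (P : Proc Sg Name) : Proc Sg Name
  /-- input on the channel `M`, binding one index in `P` -/
  | input (M : Term Sg.toCtorSig Name) (P : Proc Sg Name) : Proc Sg Name
  | nil : Proc Sg Name
  | par (P Q : Proc Sg Name) : Proc Sg Name
  | repl (P : Proc Sg Name) : Proc Sg Name
  /-- restriction, binding one index in `P` -/
  | res (a : Name) (P : Proc Sg Name) : Proc Sg Name
  /-- destructor application `let x = g(M₁, …, Mₙ) in P else Q`, binding one index in `P` -/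
  | letDtor (g : Sg.Dtor) (Ms : Fin (Sg.dtorArity g) → Term Sg.toCtorSig Name)
      (P Q : Proc Sg Name) : Proc Sg Name
  /-- `if M = N then P else Q` -/
  | cond (M N : Term Sg.toCtorSig Name) (P Q : Proc Sg Name) : Proc Sg Name
  | event (M : Term Sg.toCtorSig Name) (P : Proc Sg Name) : Proc Sg Name

namespace Proc

variable {Sg : Signature.{u, v}} {Name : Type w}

def Scoped : ℕ → Proc Sg Name → Prop
  | n, .output M N P => M.Scoped n ∧ N.Scoped n ∧ P.Scoped n
  | n, .input M P => M.Scoped n ∧ P.Scoped (n + 1)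
  | _, .nil => True
  | n, .par P Q => P.Scoped n ∧ Q.Scoped n
  | n, .repl P => P.Scoped n
  | n, .res _ P => P.Scoped (n + 1)
  | n, .letDtor _ Ms P Q => (∀ j, (Ms j).Scoped n) ∧ P.Scoped (n + 1) ∧ Q.Scoped n
  | n, .cond M N P Q => M.Scoped n ∧ N.Scoped n ∧ P.Scoped n ∧ Q.Scoped n
  | n, .event M P => M.Scoped n ∧ P.Scoped n

/-- No free variables; free names are allowed. -/
def Closed (P : Proc Sg Name) : Prop := P.Scoped 0

/-- Free names. -/
def fn : Proc Sg Name → Set Name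
  | .output M N P => M.fn ∪ N.fn ∪ P.fn
  | .input M P => M.fn ∪ P.fn
  | .nil => ∅
  | .par P Q => P.fn ∪ Q.fn
  | .repl P => P.fn
  | .res _ P => P.fn
  | .letDtor _ Ms P Q => (⋃ j, (Ms j).fn) ∪ P.fn ∪ Q.fn
  | .cond M N P Q => M.fn ∪ N.fn ∪ P.fn ∪ Q.fn
  | .event M P => M.fn ∪ P.fn

def NoEvents : Proc Sg Name → Prop
  | .output _ _ P => P.NoEvents
  | .input _ P => P.NoEvents
  | .nil => True
  | .par P Q => P.NoEvents ∧ Q.NoEvents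
  | .repl P => P.NoEvents
  | .res _ P => P.NoEvents
  | .letDtor _ _ P Q => P.NoEvents ∧ Q.NoEvents
  | .cond _ _ P Q => P.NoEvents ∧ Q.NoEvents
  | .event _ _ => False

/-- Only public constructors and destructors are used. -/
def PublicOnly : Proc Sg Name → Prop
  | .output M N P => M.PublicOnly ∧ N.PublicOnly ∧ P.PublicOnly
  | .input M P => M.PublicOnly ∧ P.PublicOnly
  | .nil => True
  | .par P Q => P.PublicOnly ∧ Q.PublicOnly
  | .repl P => P.PublicOnly
  | .res _ P => P.PublicOnly
  | .letDtor g Ms P Q =>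
      Sg.dtorPublic g ∧ (∀ j, (Ms j).PublicOnly) ∧ P.PublicOnly ∧ Q.PublicOnly
  | .cond M N P Q => M.PublicOnly ∧ N.PublicOnly ∧ P.PublicOnly ∧ Q.PublicOnly
  | .event M P => M.PublicOnly ∧ P.PublicOnly

end Proc

/-- `Q` is an `Init`-adversary: a closed process with free names in `Init`, without events, that
uses no private constructor or destructor. -/
structure IsAdversary {Sg : Signature.{u, v}} {Name : Type w} (Init : Finset Name)
    (Q : Proc Sg Name) : Prop where
  closed : Q.Closed
  fn_subset : Q.fn ⊆ (Init : Set Name)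
  noEvents : Q.NoEvents
  publicOnly : Q.PublicOnly

/-! ### Instrumented processes -/

/-- Session identifiers: variables (de Bruijn indices in instrumented processes, bound by the
replications; variables `0, 1, 2, …` of the sort of session identifiers in patterns) and
constants. -/
inductive SessId (Sid : Type x) : Type x where
  | var (i : ℕ) : SessId Sid
  | const (l : Sid) : SessId Sid

/-- Labels of restrictions. -/
inductive Label (C : CtorSig.{u}) (Name : Type w) (Sid : Type x) : Type (max u w x) where
  /-- `a[M₁, …, Mₙ, i₁, …, iₘ]`, in honest processes -/
  | honest (a : Name) (Ms : List (Term C Name)) (ids : List (SessId Sid)) : Label C Name Sid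
  /-- `b₀[a[i₁, …, iₘ]]`, in the adversary -/
  | adv (a : Name) (ids : List (SessId Sid)) : Label C Name Sid

/-- Instrumented processes. A replication binds one session index in its body. The label of a
restriction is outside the scope of that restriction. -/
inductive IProc (Sg : Signature.{u, v}) (Name : Type w) (Sid : Type x) : Type (max u v w x) where
  | output (M N : Term Sg.toCtorSig Name) (P : IProc Sg Name Sid) : IProc Sg Name Sid
  | input (M : Term Sg.toCtorSig Name) (P : IProc Sg Name Sid) : IProc Sg Name Sid
  | nil : IProc Sg Name Sid
  | par (P Q : IProc Sg Name Sid) : IProc Sg Name Sid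
  | repl (P : IProc Sg Name Sid) : IProc Sg Name Sid
  | res (lab : Label Sg.toCtorSig Name Sid) (P : IProc Sg Name Sid) : IProc Sg Name Sid
  | letDtor (g : Sg.Dtor) (Ms : Fin (Sg.dtorArity g) → Term Sg.toCtorSig Name)
      (P Q : IProc Sg Name Sid) : IProc Sg Name Sid
  | cond (M N : Term Sg.toCtorSig Name) (P Q : IProc Sg Name Sid) : IProc Sg Name Sid
  | event (M : Term Sg.toCtorSig Name) (P : IProc Sg Name Sid) : IProc Sg Name Sid

/-- Substitution of the constant `l` for the session index `k`. -/
def SessId.openAt {Sid : Type x} (l : Sid) (k : ℕ) : SessId Sid → SessId Sid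
  | .var j => if j = k then .const l else .var j
  | .const m => .const m

namespace Label

variable {C : CtorSig.{u}} {Name : Type w} {Sid : Type x}

def openTerm (M : Term C Name) (k : ℕ) : Label C Name Sid → Label C Name Sid
  | .honest a Ms ids => .honest a (Ms.map (Term.openAt M k)) ids
  | .adv a ids => .adv a ids

def openSess (l : Sid) (k : ℕ) : Label C Name Sid → Label C Name Sid
  | .honest a Ms ids => .honest a Ms (ids.map (SessId.openAt l k))
  | .adv a ids => .adv a (ids.map (SessId.openAt l k))

/-- Names that occur in the terms of the label. -/
def fn : Label C Name Sid → Set Name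
  | .honest _ Ms _ => {b | ∃ M ∈ Ms, b ∈ M.fn}
  | .adv _ _ => ∅

end Label

namespace IProc

variable {Sg : Signature.{u, v}} {Name : Type w} {Sid : Type x}

/-- Substitution `P{M/x}` of the closed term `M` for the index `k`. -/
def openTerm (M : Term Sg.toCtorSig Name) : ℕ → IProc Sg Name Sid → IProc Sg Name Sid
  | k, .output M₁ N₁ P => .output (Term.openAt M k M₁) (Term.openAt M k N₁) (openTerm M k P)
  | k, .input M₁ P => .input (Term.openAt M k M₁) (openTerm M (k + 1) P)
  | _, .nil => .nil
  | k, .par P Q => .par (openTerm M k P) (openTerm M k Q)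
  | k, .repl P => .repl (openTerm M k P)
  | k, .res lab P => .res (lab.openTerm M k) (openTerm M (k + 1) P)
  | k, .letDtor g Ms P Q =>
      .letDtor g (fun j => Term.openAt M k (Ms j)) (openTerm M (k + 1) P) (openTerm M k Q)
  | k, .cond M₁ N₁ P Q =>
      .cond (Term.openAt M k M₁) (Term.openAt M k N₁) (openTerm M k P) (openTerm M k Q)
  | k, .event M₁ P => .event (Term.openAt M k M₁) (openTerm M k P)

/-- Substitution `P{l/i}` of the constant session identifier `l` for the session index `k`. -/
def openSess (l : Sid) : ℕ → IProc Sg Name Sid → IProc Sg Name Sid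
  | k, .output M N P => .output M N (openSess l k P)
  | k, .input M P => .input M (openSess l k P)
  | _, .nil => .nil
  | k, .par P Q => .par (openSess l k P) (openSess l k Q)
  | k, .repl P => .repl (openSess l (k + 1) P)
  | k, .res lab P => .res (lab.openSess l k) (openSess l k P)
  | k, .letDtor g Ms P Q => .letDtor g Ms (openSess l k P) (openSess l k Q)
  | k, .cond M N P Q => .cond M N (openSess l k P) (openSess l k Q)
  | k, .event M P => .event M (openSess l k P)

/-- Free names. -/
def fn : IProc Sg Name Sid → Set Name
  | .output M N P => M.fn ∪ N.fn ∪ P.fn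
  | .input M P => M.fn ∪ P.fn
  | .nil => ∅
  | .par P Q => P.fn ∪ Q.fn
  | .repl P => P.fn
  | .res lab P => lab.fn ∪ P.fn
  | .letDtor _ Ms P Q => (⋃ j, (Ms j).fn) ∪ P.fn ∪ Q.fn
  | .cond M N P Q => M.fn ∪ N.fn ∪ P.fn ∪ Q.fn
  | .event M P => M.fn ∪ P.fn

end IProc

namespace Proc

variable {Sg : Signature.{u, v}} {Name : Type w}

open Classical in
/-- Instrumentation of a subprocess; `t` lists, from top to bottom, the variables bound above by
inputs and by non-deterministic destructor applications, and `s` the session identifiers of the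
replications above. -/
noncomputable def instrAux (Sid : Type x) :
    List ℕ → List ℕ → Proc Sg Name → IProc Sg Name Sid
  | t, s, .output M N P => .output M N (instrAux Sid t s P)
  | t, s, .input M P => .input M (instrAux Sid (t.map (· + 1) ++ [0]) s P)
  | _, _, .nil => .nil
  | t, s, .par P Q => .par (instrAux Sid t s P) (instrAux Sid t s Q)
  | t, s, .repl P => .repl (instrAux Sid t (s.map (· + 1) ++ [0]) P)
  | t, s, .res a P =>
      .res (.honest a (t.map .bound) (s.map .var)) (instrAux Sid (t.map (· + 1)) s P)
  | t, s, .letDtor g Ms P Q =>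
      .letDtor g Ms
        (instrAux Sid
          (t.map (· + 1) ++ if NonDeterministic Sg Name g then [0] else []) s P)
        (instrAux Sid t s Q)
  | t, s, .cond M N P Q => .cond M N (instrAux Sid t s P) (instrAux Sid t s Q)
  | t, s, .event M P => .event M (instrAux Sid t s P)

/-- `instr(P)`, the instrumentation of the protocol. -/
noncomputable def instr (Sid : Type x) (P : Proc Sg Name) : IProc Sg Name Sid :=
  instrAux Sid [] [] P

/-- Instrumentation of a subprocess of the adversary; `s` lists, from top to bottom, the session
identifiers of the replications above. -/
def instrAdvAux (Sid : Type x) : List ℕ → Proc Sg Name → IProc Sg Name Sid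
  | s, .output M N P => .output M N (instrAdvAux Sid s P)
  | s, .input M P => .input M (instrAdvAux Sid s P)
  | _, .nil => .nil
  | s, .par P Q => .par (instrAdvAux Sid s P) (instrAdvAux Sid s Q)
  | s, .repl P => .repl (instrAdvAux Sid (s.map (· + 1) ++ [0]) P)
  | s, .res a P => .res (.adv a (s.map .var)) (instrAdvAux Sid s P)
  | s, .letDtor g Ms P Q => .letDtor g Ms (instrAdvAux Sid s P) (instrAdvAux Sid s Q)
  | s, .cond M N P Q => .cond M N (instrAdvAux Sid s P) (instrAdvAux Sid s Q)
  | s, .event M P => .event M (instrAdvAux Sid s P)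

/-- `instrAdv(Q)`, the instrumentation of the adversary. -/
def instrAdv (Sid : Type x) (Q : Proc Sg Name) : IProc Sg Name Sid :=
  instrAdvAux Sid [] Q

end Proc

/-! ### Patterns, facts and substitutions -/

/-- Patterns, over the ordinary variables `0, 1, 2, …`. The special name function symbol `b₀` is a
constructor of its own, hence distinct from all other name function symbols. -/
inductive Pattern (C : CtorSig.{u}) (Name : Type w) (Sid : Type x) : Type (max u w x) where
  | var (n : ℕ) : Pattern C Name Sid
  /-- `a[p₁, …, pₙ, i₁, …, iₘ]` -/
  | name (a : Name) (n : ℕ) (ps : Fin n → Pattern C Name Sid) (ids : List (SessId Sid)) :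
      Pattern C Name Sid
  /-- `b₀[p]` -/
  | bzero (p : Pattern C Name Sid) : Pattern C Name Sid
  | app (f : C.Ctor) (args : Fin (C.ctorArity f) → Pattern C Name Sid) : Pattern C Name Sid

/-- Substitutions: ordinary variables are mapped to patterns, session identifier variables to
session identifiers. -/
structure Subst (C : CtorSig.{u}) (Name : Type w) (Sid : Type x) where
  ord : ℕ → Pattern C Name Sid
  sess : ℕ → SessId Sid

namespace SessId

variable {Sid : Type x}

def subst (τ : ℕ → SessId Sid) : SessId Sid → SessId Sid
  | .var i => τ i
  | .const l => .const l

end SessId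

namespace Pattern

variable {C : CtorSig.{u}} {Name : Type w} {Sid : Type x}

/-- `a[]` -/
def free (a : Name) : Pattern C Name Sid := .name a 0 Fin.elim0 []

def subst (σ : Subst C Name Sid) : Pattern C Name Sid → Pattern C Name Sid
  | .var n => σ.ord n
  | .name a n ps ids => .name a n (fun j => (ps j).subst σ) (ids.map (SessId.subst σ.sess))
  | .bzero p => .bzero (p.subst σ)
  | .app f args => .app f fun j => (args j).subst σ

/-- Ordinary variables. -/
def vars : Pattern C Name Sid → Set ℕ
  | .var n => {n}
  | .name _ _ ps _ => ⋃ j, (ps j).vars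
  | .bzero p => p.vars
  | .app _ args => ⋃ j, (args j).vars

/-- Session identifier variables. -/
def svars : Pattern C Name Sid → Set ℕ
  | .var _ => ∅
  | .name _ _ ps ids => (⋃ j, (ps j).svars) ∪ {i | SessId.var i ∈ ids}
  | .bzero p => p.svars
  | .app _ args => ⋃ j, (args j).svars

end Pattern

/-- Terms without names are also patterns: application of a substitution to a term of a rewrite
rule, with patterns as results. -/
def RuleTerm.toPattern {C : CtorSig.{u}} {Name : Type w} {Sid : Type x}
    (σ : ℕ → Pattern C Name Sid) : RuleTerm C → Pattern C Name Sid
  | .var n => σ n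
  | .app f args => .app f fun j => (args j).toPattern σ

inductive Fact (C : CtorSig.{u}) (Name : Type w) (Sid : Type x) : Type (max u w x) where
  | attacker (p : Pattern C Name Sid) : Fact C Name Sid
  | message (p q : Pattern C Name Sid) : Fact C Name Sid
  /-- must-event -/
  | mevent (p : Pattern C Name Sid) : Fact C Name Sid
  /-- may-event -/
  | event (p : Pattern C Name Sid) : Fact C Name Sid

namespace Fact

variable {C : CtorSig.{u}} {Name : Type w} {Sid : Type x}

def subst (σ : Subst C Name Sid) : Fact C Name Sid → Fact C Name Sid
  | .attacker p => .attacker (p.subst σ)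
  | .message p q => .message (p.subst σ) (q.subst σ)
  | .mevent p => .mevent (p.subst σ)
  | .event p => .event (p.subst σ)

def vars : Fact C Name Sid → Set ℕ
  | .attacker p => p.vars
  | .message p q => p.vars ∪ q.vars
  | .mevent p => p.vars
  | .event p => p.vars

def svars : Fact C Name Sid → Set ℕ
  | .attacker p => p.svars
  | .message p q => p.svars ∪ q.svars
  | .mevent p => p.svars
  | .event p => p.svars

/-- No variables of either sort. -/
def Closed (F : Fact C Name Sid) : Prop := F.vars = ∅ ∧ F.svars = ∅

end Fact

/-! ### Semantics of instrumented processes -/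

/-- Environments: mappings from the names in `dom` to patterns (the values of `map` outside `dom`
are irrelevant). -/
structure Env (C : CtorSig.{u}) (Name : Type w) (Sid : Type x) where
  dom : Set Name
  map : Name → Pattern C Name Sid

namespace Env

variable {C : CtorSig.{u}} {Name : Type w} {Sid : Type x}

open Classical in
/-- `E[a ↦ p]` -/
noncomputable def extend (E : Env C Name Sid) (a : Name) (p : Pattern C Name Sid) :
    Env C Name Sid :=
  ⟨insert a E.dom, Function.update E.map a p⟩

/-- `E(M)`: the extension of `E` to terms as a substitution. -/
def term (E : Env C Name Sid) : Term C Name → Pattern C Name Sid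
  | .bound k => .var k
  | .name a => E.map a
  | .app f args => .app f fun j => E.term (args j)

/-- `E(ℓ)`: the extension of `E` to restriction labels. -/
def label (E : Env C Name Sid) : Label C Name Sid → Pattern C Name Sid
  | .honest a Ms ids => .name a Ms.length (fun j => E.term (Ms.get j)) ids
  | .adv a ids => .bzero (.name a 0 Fin.elim0 ids)

end Env

/-- Semantic configurations `S, E, Ps`. -/
structure Config (Sg : Signature.{u, v}) (Name : Type w) (Sid : Type x) where
  ids : Set Sid
  env : Env Sg.toCtorSig Name Sid
  procs : Multiset (IProc Sg Name Sid)

section Semantics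

variable {Sg : Signature.{u, v}} {Name : Type w} {Sid : Type x}

/-- The reduction relation. -/
inductive Step : Config Sg Name Sid → Config Sg Name Sid → Prop
  | nil (S : Set Sid) (E : Env Sg.toCtorSig Name Sid) (Ps : Multiset (IProc Sg Name Sid)) :
      Step ⟨S, E, .nil ::ₘ Ps⟩ ⟨S, E, Ps⟩
  | repl (S : Set Sid) (E : Env Sg.toCtorSig Name Sid) (Ps : Multiset (IProc Sg Name Sid))
      (P : IProc Sg Name Sid) (l : Sid) (hl : l ∈ S) :
      Step ⟨S, E, .repl P ::ₘ Ps⟩ ⟨S \ {l}, E, P.openSess l 0 ::ₘ .repl P ::ₘ Ps⟩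
  | par (S : Set Sid) (E : Env Sg.toCtorSig Name Sid) (Ps : Multiset (IProc Sg Name Sid))
      (P Q : IProc Sg Name Sid) :
      Step ⟨S, E, .par P Q ::ₘ Ps⟩ ⟨S, E, P ::ₘ Q ::ₘ Ps⟩
  | res (S : Set Sid) (E : Env Sg.toCtorSig Name Sid) (Ps : Multiset (IProc Sg Name Sid))
      (lab : Label Sg.toCtorSig Name Sid) (P : IProc Sg Name Sid) (a : Name) (ha : a ∉ E.dom) :
      Step ⟨S, E, .res lab P ::ₘ Ps⟩
        ⟨S, E.extend a (E.label lab), P.openTerm (.name a) 0 ::ₘ Ps⟩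
  | comm (S : Set Sid) (E : Env Sg.toCtorSig Name Sid) (Ps : Multiset (IProc Sg Name Sid))
      (N M : Term Sg.toCtorSig Name) (Q P : IProc Sg Name Sid) :
      Step ⟨S, E, .output N M Q ::ₘ .input N P ::ₘ Ps⟩ ⟨S, E, Q ::ₘ P.openTerm M 0 ::ₘ Ps⟩
  | dtorThen (S : Set Sid) (E : Env Sg.toCtorSig Name Sid) (Ps : Multiset (IProc Sg Name Sid))
      (g : Sg.Dtor) (Ms : Fin (Sg.dtorArity g) → Term Sg.toCtorSig Name)
      (P Q : IProc Sg Name Sid) (M : Term Sg.toCtorSig Name) (h : Reduces Sg g Ms M) :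
      Step ⟨S, E, .letDtor g Ms P Q ::ₘ Ps⟩ ⟨S, E, P.openTerm M 0 ::ₘ Ps⟩
  | dtorElse (S : Set Sid) (E : Env Sg.toCtorSig Name Sid) (Ps : Multiset (IProc Sg Name Sid))
      (g : Sg.Dtor) (Ms : Fin (Sg.dtorArity g) → Term Sg.toCtorSig Name)
      (P Q : IProc Sg Name Sid) (h : ¬ ∃ M, Reduces Sg g Ms M) :
      Step ⟨S, E, .letDtor g Ms P Q ::ₘ Ps⟩ ⟨S, E, Q ::ₘ Ps⟩
  | condThen (S : Set Sid) (E : Env Sg.toCtorSig Name Sid) (Ps : Multiset (IProc Sg Name Sid))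
      (M : Term Sg.toCtorSig Name) (P Q : IProc Sg Name Sid) :
      Step ⟨S, E, .cond M M P Q ::ₘ Ps⟩ ⟨S, E, P ::ₘ Ps⟩
  | condElse (S : Set Sid) (E : Env Sg.toCtorSig Name Sid) (Ps : Multiset (IProc Sg Name Sid))
      (M N : Term Sg.toCtorSig Name) (P Q : IProc Sg Name Sid) (h : M ≠ N) :
      Step ⟨S, E, .cond M N P Q ::ₘ Ps⟩ ⟨S, E, Q ::ₘ Ps⟩
  | event (S : Set Sid) (E : Env Sg.toCtorSig Name Sid) (Ps : Multiset (IProc Sg Name Sid))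
      (M : Term Sg.toCtorSig Name) (P : IProc Sg Name Sid) :
      Step ⟨S, E, .event M P ::ₘ Ps⟩ ⟨S, E, P ::ₘ Ps⟩

end Semantics

/-- A trace: a finite sequence of configurations, each reducing to the next one. -/
structure Trace (Sg : Signature.{u, v}) (Name : Type w) (Sid : Type x) where
  length : ℕ
  config : Fin (length + 1) → Config Sg Name Sid
  step : ∀ j : Fin length, Step (config j.castSucc) (config j.succ)

/-- Atoms. -/
inductive Atom (C : CtorSig.{u}) (Name : Type w) : Type (max u w) where
  | attacker (M : Term C Name) : Atom C Name
  | message (M N : Term C Name) : Atom C Name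
  | event (M : Term C Name) : Atom C Name

/-- `E(α)`: the extension of `E` to atoms. -/
def Env.atom {C : CtorSig.{u}} {Name : Type w} {Sid : Type x} (E : Env C Name Sid) :
    Atom C Name → Fact C Name Sid
  | .attacker M => .attacker (E.term M)
  | .message M N => .message (E.term M) (E.term N)
  | .event M => .event (E.term M)

namespace Trace

variable {Sg : Signature.{u, v}} {Name : Type w} {Sid : Type x}

def first (T : Trace Sg Name Sid) : Config Sg Name Sid := T.config 0

def last (T : Trace Sg Name Sid) : Config Sg Name Sid := T.config (Fin.last T.length)

/-- The trace contains a reduction in which `N` is sent on the channel `M`. -/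
def Sends (T : Trace Sg Name Sid) (M N : Term Sg.toCtorSig Name) : Prop :=
  ∃ (j : Fin T.length) (S : Set Sid) (E : Env Sg.toCtorSig Name Sid)
    (Ps : Multiset (IProc Sg Name Sid)) (P Q : IProc Sg Name Sid),
    T.config j.castSucc = ⟨S, E, .output M N Q ::ₘ .input M P ::ₘ Ps⟩ ∧
    T.config j.succ = ⟨S, E, Q ::ₘ P.openTerm N 0 ::ₘ Ps⟩

/-- The trace contains a reduction that executes the event `M`. -/
def Executes (T : Trace Sg Name Sid) (M : Term Sg.toCtorSig Name) : Prop :=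
  ∃ (j : Fin T.length) (S : Set Sid) (E : Env Sg.toCtorSig Name Sid)
    (Ps : Multiset (IProc Sg Name Sid)) (P : IProc Sg Name Sid),
    T.config j.castSucc = ⟨S, E, .event M P ::ₘ Ps⟩ ∧
    T.config j.succ = ⟨S, E, P ::ₘ Ps⟩

/-- The trace satisfies an atom. -/
def SatisfiesAtom (Init : Finset Name) (T : Trace Sg Name Sid) : Atom Sg.toCtorSig Name → Prop
  | .attacker M => ∃ c ∈ Init, T.Sends (.name c) M
  | .message M N => T.Sends M N
  | .event M => T.Executes M

/-- The trace satisfies the fact `F`: it satisfies an atom `α` such that `E'(α) = F`, where `E'` is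
the environment of its last configuration. -/
def Satisfies (Init : Finset Name) (T : Trace Sg Name Sid) (F : Fact Sg.toCtorSig Name Sid) :
    Prop :=
  ∃ α : Atom Sg.toCtorSig Name, T.SatisfiesAtom Init α ∧ T.last.env.atom α = F

end Trace

/-! ### Horn clauses and derivability -/

/-- Horn clauses `F₁ ∧ … ∧ Fₙ ⇒ F`. -/
structure Clause (C : CtorSig.{u}) (Name : Type w) (Sid : Type x) where
  hyps : List (Fact C Name Sid)
  concl : Fact C Name Sid

/-- A closed fact is derivable from the clauses `R` when it is the conclusion of a finite tree of
closed instances of clauses of `R`. All facts in the tree are closed, since every hypothesis is in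
turn the conclusion of an instance with a closed conclusion. -/
inductive Derivable {C : CtorSig.{u}} {Name : Type w} {Sid : Type x}
    (R : Set (Clause C Name Sid)) : Fact C Name Sid → Prop
  | intro (cl : Clause C Name Sid) (hcl : cl ∈ R) (σ : Subst C Name Sid)
      (hclosed : (cl.concl.subst σ).Closed)
      (hyps : ∀ F ∈ cl.hyps, Derivable R (F.subst σ)) : Derivable R (cl.concl.subst σ)

/-- A set of facts, seen as clauses without hypotheses. -/
def factClauses {C : CtorSig.{u}} {Name : Type w} {Sid : Type x}
    (𝓕 : Set (Fact C Name Sid)) : Set (Clause C Name Sid) :=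
  {cl | cl.hyps = [] ∧ cl.concl ∈ 𝓕}

/-- `δ ∘ σ` -/
def Subst.comp {C : CtorSig.{u}} {Name : Type w} {Sid : Type x} (δ σ : Subst C Name Sid) :
    Subst C Name Sid :=
  ⟨fun n => (σ.ord n).subst δ, fun i => (σ.sess i).subst δ.sess⟩

/-- `σ` is a most general unifier of `p` and `q`. -/
def IsMGU {C : CtorSig.{u}} {Name : Type w} {Sid : Type x} (p q : Pattern C Name Sid)
    (σ : Subst C Name Sid) : Prop :=
  p.subst σ = q.subst σ ∧
    ∀ θ : Subst C Name Sid, p.subst θ = q.subst θ → ∃ δ : Subst C Name Sid, θ = δ.comp σ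

/-- `(σ, σ')` is a most general pair of substitutions with `σ pⱼ = σ' p'ⱼ` for all `j`, where `σ'`
acts on the variables of the rewrite rule. -/
def IsMGPair {C : CtorSig.{u}} {Name : Type w} {Sid : Type x} {n : ℕ}
    (p : Fin n → Pattern C Name Sid) (p' : Fin n → RuleTerm C)
    (σ : Subst C Name Sid) (σ' : ℕ → Pattern C Name Sid) : Prop :=
  (∀ j, (p j).subst σ = (p' j).toPattern σ') ∧
    ∀ (θ : Subst C Name Sid) (θ' : ℕ → Pattern C Name Sid),
      (∀ j, (p j).subst θ = (p' j).toPattern θ') →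
      ∃ δ : Subst C Name Sid, θ = δ.comp σ ∧ ∀ n, θ' n = (σ' n).subst δ

/-- The environments `ρ` of the translation. A free name `a` is always mapped to `a[]`; `terms`
lists the patterns of the bound variables and names, and `sess` the session identifiers of the
replications, in the order of de Bruijn indices. -/
structure TrEnv (C : CtorSig.{u}) (Name : Type w) (Sid : Type x) where
  terms : List (Pattern C Name Sid)
  sess : List (SessId Sid)

namespace TrEnv

variable {C : CtorSig.{u}} {Name : Type w} {Sid : Type x}

/-- `ρ(M)` (the default value concerns indices out of scope only). -/
def term (ρ : TrEnv C Name Sid) : Term C Name → Pattern C Name Sid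
  | .bound k => ρ.terms.getD k (.var k)
  | .name a => .free a
  | .app f args => .app f fun j => ρ.term (args j)

/-- `ρ(i)` (the default value concerns indices out of scope only). -/
def sessId (ρ : TrEnv C Name Sid) : SessId Sid → SessId Sid
  | .var k => ρ.sess.getD k (.var k)
  | .const l => .const l

def label (ρ : TrEnv C Name Sid) : Label C Name Sid → Pattern C Name Sid
  | .honest a Ms ids => .name a Ms.length (fun j => ρ.term (Ms.get j)) (ids.map ρ.sessId)
  | .adv a ids => .bzero (.name a 0 Fin.elim0 (ids.map ρ.sessId))

/-- `ρ[x ↦ p]` -/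
def push (ρ : TrEnv C Name Sid) (p : Pattern C Name Sid) : TrEnv C Name Sid :=
  ⟨p :: ρ.terms, ρ.sess⟩

/-- `ρ[i ↦ i']` for a session identifier -/
def pushSess (ρ : TrEnv C Name Sid) (i : SessId Sid) : TrEnv C Name Sid :=
  ⟨ρ.terms, i :: ρ.sess⟩

/-- `σρ` -/
def subst (σ : Subst C Name Sid) (ρ : TrEnv C Name Sid) : TrEnv C Name Sid :=
  ⟨ρ.terms.map (Pattern.subst σ), ρ.sess.map (SessId.subst σ.sess)⟩

/-- The ordinary variable `n` does not occur in `ρ` and `H`. -/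
def FreshVar (ρ : TrEnv C Name Sid) (H : List (Fact C Name Sid)) (n : ℕ) : Prop :=
  (∀ p ∈ ρ.terms, n ∉ p.vars) ∧ ∀ F ∈ H, n ∉ F.vars

/-- The session identifier variable `i` does not occur in `ρ` and `H`. -/
def FreshSess (ρ : TrEnv C Name Sid) (H : List (Fact C Name Sid)) (i : ℕ) : Prop :=
  (∀ p ∈ ρ.terms, i ∉ p.svars) ∧ SessId.var i ∉ ρ.sess ∧ ∀ F ∈ H, i ∉ F.svars

end TrEnv

/-- The translation `⟦P⟧ρH`. Clauses are considered up to renaming of their variables: the set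
contains the clauses for all choices of fresh variables and of most general unifiers. -/
def clausesOf {Sg : Signature.{u, v}} {Name : Type w} {Sid : Type x} :
    IProc Sg Name Sid → TrEnv Sg.toCtorSig Name Sid → List (Fact Sg.toCtorSig Name Sid) →
    Set (Clause Sg.toCtorSig Name Sid)
  | .nil, _, _ => ∅
  | .par P Q, ρ, H => clausesOf P ρ H ∪ clausesOf Q ρ H
  | .repl P, ρ, H =>
      {cl | ∃ i, ρ.FreshSess H i ∧ cl ∈ clausesOf P (ρ.pushSess (.var i)) H}
  | .res lab P, ρ, H => clausesOf P (ρ.push (ρ.label lab)) H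
  | .input M P, ρ, H =>
      {cl | ∃ n, ρ.FreshVar H n ∧
        cl ∈ clausesOf P (ρ.push (.var n)) (H ++ [.message (ρ.term M) (.var n)])}
  | .output M N P, ρ, H => clausesOf P ρ H ∪ {⟨H, .message (ρ.term M) (ρ.term N)⟩}
  | .letDtor g Ms P Q, ρ, H =>
      {cl | ∃ r ∈ Sg.rules g, ∃ σ σ', IsMGPair (fun j => ρ.term (Ms j)) r.lhs σ σ' ∧
        cl ∈ clausesOf P ((ρ.subst σ).push (r.rhs.toPattern σ')) (H.map (Fact.subst σ))} ∪
      clausesOf Q ρ H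
  | .cond M N P Q, ρ, H =>
      {cl | ∃ σ, IsMGU (ρ.term M) (ρ.term N) σ ∧
        cl ∈ clausesOf P (ρ.subst σ) (H.map (Fact.subst σ))} ∪
      clausesOf Q ρ H
  | .event M P, ρ, H =>
      clausesOf P ρ (H ++ [.mevent (ρ.term M)]) ∪ {⟨H, .event (ρ.term M)⟩}

/-- The clauses for the attacker. -/
inductive AttackerClause (Sg : Signature.{u, v}) {Name : Type w} (Sid : Type x)
    (Init : Finset Name) : Clause Sg.toCtorSig Name Sid → Prop
  /-- `attacker(a[])` for `a ∈ Init` -/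
  | init (a : Name) (ha : a ∈ Init) : AttackerClause Sg Sid Init ⟨[], .attacker (.free a)⟩
  /-- `attacker(b₀[x])` -/
  | rn : AttackerClause Sg Sid Init ⟨[], .attacker (.bzero (.var 0))⟩
  /-- public constructors -/
  | rf (f : Sg.Ctor) (hf : Sg.ctorPublic f) :
      AttackerClause Sg Sid Init
        ⟨List.ofFn fun j : Fin (Sg.ctorArity f) => .attacker (.var j),
          .attacker (.app f fun j => .var j)⟩
  /-- public destructors -/
  | rg (g : Sg.Dtor) (hg : Sg.dtorPublic g)
      (r : RewriteRule Sg.toCtorSig (Sg.dtorArity g)) (hr : r ∈ Sg.rules g) :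
      AttackerClause Sg Sid Init
        ⟨List.ofFn fun j => .attacker ((r.lhs j).toPattern .var),
          .attacker (r.rhs.toPattern .var)⟩
  /-- `message(x, y) ∧ attacker(x) ⇒ attacker(y)` -/
  | rl : AttackerClause Sg Sid Init
        ⟨[.message (.var 0) (.var 1), .attacker (.var 0)], .attacker (.var 1)⟩
  /-- `attacker(x) ∧ attacker(y) ⇒ message(x, y)` -/
  | rs : AttackerClause Sg Sid Init
        ⟨[.attacker (.var 0), .attacker (.var 1)], .message (.var 0) (.var 1)⟩

/-- The set of clauses `R_{P, Init}` of the instrumented process `P`. -/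
def protocolClauses {Sg : Signature.{u, v}} {Name : Type w} {Sid : Type x}
    (P : IProc Sg Name Sid) (Init : Finset Name) : Set (Clause Sg.toCtorSig Name Sid) :=
  clausesOf P ⟨[], []⟩ [] ∪ {cl | AttackerClause Sg Sid Init cl}

end Corr

/-!
Every fact that a trace satisfies is derivable because the clauses define a type system for
instrumented processes in which the protocol and the adversary are both well-typed, and which is
preserved by reduction.

A *valuation* interprets names, term indices and session indices by patterns and session
identifiers. The judgement `IProc.Typed R v P`, defined by recursion on `P`, says that whatever `P`
outputs or executes under the valuation `v` is derivable from `R`; an input quantifies over all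
messages derivable on its channel, a destructor application over all matching rules, and the
continuation of an event may assume the must-event.

* The protocol is well-typed (`IProc.typed_of_clausesOf_subset`). Along the translation
  `⟦P⟧ρH` a substitution `θ` is maintained, with `θρ` the current valuation and the instances by
  `θ` of the facts in `H` derivable. Inputs and replications extend `θ` to a fresh variable. At a
  test that succeeds, `θ` is a unifier, so that a most general unifier exists and `θ` factors
  through it. This needs first-order unification for patterns with two sorts of variables
  (`exists_isMGU`, `exists_isMGPair`).
* The adversary is well-typed (`Proc.typed_instrAdvAux`): it only ever handles patterns that the
  attacker clauses give to the attacker.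
* A step preserves typing (`Step.accepts`). Terms that are substituted for an index are closed,
  hence opening a binder amounts to extending the valuation (`IProc.Typed.openTerm`,
  `IProc.Typed.openSess`). Equal terms have equal interpretations and rewrite rules act in the same
  way on terms and on patterns, so every branch that is taken was accounted for. The must-event
  that the continuation of an event needs is granted by the hypothesis on the events of the trace.

Environments only grow along a trace, on names that were not in their domain, so a closed term has
the same image in the environment of the step that uses it and in that of the last configuration
(`Trace.derivable_of_satisfies`).
-/

namespace Corr

/-! ### Substitutions -/

section Substitution

variable {C : CtorSig.{u}} {Name : Type w} {Sid : Type x}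

theorem SessId.subst_subst (s : SessId Sid) (σ δ : ℕ → SessId Sid) :
    (s.subst σ).subst δ = s.subst fun i => (σ i).subst δ := by
  cases s <;> rfl

theorem SessId.subst_congr {s : SessId Sid} {σ τ : ℕ → SessId Sid}
    (h : ∀ i, s = .var i → σ i = τ i) : s.subst σ = s.subst τ := by
  cases s with
  | var i => exact h i rfl
  | const l => rfl

theorem SessId.subst_var (s : SessId Sid) : s.subst .var = s := by
  cases s <;> rfl

theorem Pattern.subst_subst (p : Pattern C Name Sid) (σ δ : Subst C Name Sid) :
    (p.subst σ).subst δ = p.subst (δ.comp σ) := by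
  induction p with
  | var n => rfl
  | name a n ps ids ih =>
    simp only [Pattern.subst, ih, List.map_map]
    congr 2
    funext s
    exact s.subst_subst _ _
  | bzero p ih => simp only [Pattern.subst, ih]
  | app f args ih => simp only [Pattern.subst, ih]

theorem Pattern.subst_congr {p : Pattern C Name Sid} {σ τ : Subst C Name Sid}
    (hord : ∀ n ∈ p.vars, σ.ord n = τ.ord n) (hsess : ∀ i ∈ p.svars, σ.sess i = τ.sess i) :
    p.subst σ = p.subst τ := by
  induction p with
  | var n => exact hord n rfl
  | name a n ps ids ih =>
    simp only [Pattern.subst]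
    congr 1
    · funext j
      exact ih j (fun n hn => hord n (Set.mem_iUnion.2 ⟨j, hn⟩))
        fun i hi => hsess i (.inl (Set.mem_iUnion.2 ⟨j, hi⟩))
    · refine List.map_congr_left fun s hs => SessId.subst_congr fun i hi => ?_
      exact hsess i (.inr (by simpa [hi] using hs))
  | bzero p ih => simp only [Pattern.subst, ih hord hsess]
  | app f args ih =>
    simp only [Pattern.subst]
    congr 1
    funext j
    exact ih j (fun n hn => hord n (Set.mem_iUnion.2 ⟨j, hn⟩))
      fun i hi => hsess i (Set.mem_iUnion.2 ⟨j, hi⟩)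

/-- The identity substitution. -/
def Subst.id : Subst C Name Sid := ⟨.var, .var⟩

theorem Pattern.subst_id (p : Pattern C Name Sid) : p.subst .id = p := by
  induction p with
  | var n => rfl
  | name a n ps ids ih =>
    have hids : ids.map (SessId.subst SessId.var) = ids :=
      (List.map_congr_left fun s _ => s.subst_var).trans (List.map_id _)
    simp only [Pattern.subst, ih]
    exact congrArg _ hids
  | bzero p ih => simp only [Pattern.subst, ih]
  | app f args ih => simp only [Pattern.subst, ih]

theorem Subst.comp_id (σ : Subst C Name Sid) : σ.comp .id = σ := rfl

theorem Subst.comp_assoc (τ δ σ : Subst C Name Sid) :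
    (τ.comp δ).comp σ = τ.comp (δ.comp σ) := by
  simp only [Subst.comp, Pattern.subst_subst, SessId.subst_subst]

theorem Fact.subst_subst (F : Fact C Name Sid) (σ δ : Subst C Name Sid) :
    (F.subst σ).subst δ = F.subst (δ.comp σ) := by
  cases F <;> simp only [Fact.subst, Pattern.subst_subst]

theorem Fact.subst_congr {F : Fact C Name Sid} {σ τ : Subst C Name Sid}
    (hord : ∀ n ∈ F.vars, σ.ord n = τ.ord n) (hsess : ∀ i ∈ F.svars, σ.sess i = τ.sess i) :
    F.subst σ = F.subst τ := by
  cases F with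
  | message p q =>
    simp only [Fact.subst]
    congr 1
    · exact Pattern.subst_congr (fun n h => hord n (.inl h)) fun i h => hsess i (.inl h)
    · exact Pattern.subst_congr (fun n h => hord n (.inr h)) fun i h => hsess i (.inr h)
  | _ p => exact congrArg _ (Pattern.subst_congr hord hsess)

theorem RuleTerm.toPattern_subst (r : RuleTerm C) (σ : ℕ → Pattern C Name Sid)
    (δ : Subst C Name Sid) :
    (r.toPattern σ).subst δ = r.toPattern fun n => (σ n).subst δ := by
  induction r with
  | var n => rfl
  | app f args ih => simp only [RuleTerm.toPattern, Pattern.subst, ih]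

theorem Pattern.finite_vars (p : Pattern C Name Sid) : p.vars.Finite := by
  induction p with
  | var n => exact Set.finite_singleton n
  | name a n ps ids ih => exact Set.finite_iUnion ih
  | bzero p ih => exact ih
  | app f args ih => exact Set.finite_iUnion ih

theorem SessId.finite_vars (ids : List (SessId Sid)) : {i | SessId.var i ∈ ids}.Finite :=
  (List.finite_toSet ids).preimage fun _ _ _ _ h => SessId.var.inj h

theorem Pattern.finite_svars (p : Pattern C Name Sid) : p.svars.Finite := by
  induction p with
  | var n => exact Set.finite_empty
  | name a n ps ids ih => exact (Set.finite_iUnion ih).union (SessId.finite_vars ids)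
  | bzero p ih => exact ih
  | app f args ih => exact Set.finite_iUnion ih

theorem Fact.finite_vars (F : Fact C Name Sid) : F.vars.Finite := by
  cases F with
  | message p q => exact p.finite_vars.union q.finite_vars
  | _ p => exact p.finite_vars

theorem Fact.finite_svars (F : Fact C Name Sid) : F.svars.Finite := by
  cases F with
  | message p q => exact p.finite_svars.union q.finite_svars
  | _ p => exact p.finite_svars

theorem TrEnv.exists_freshVar (ρ : TrEnv C Name Sid) (H : List (Fact C Name Sid)) :
    ∃ n, ρ.FreshVar H n := by
  have h₁ : (⋃ p ∈ {p | p ∈ ρ.terms}, p.vars).Finite :=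
    ρ.terms.finite_toSet.biUnion fun p _ => p.finite_vars
  have h₂ : (⋃ F ∈ {F | F ∈ H}, F.vars).Finite :=
    H.finite_toSet.biUnion fun F _ => F.finite_vars
  obtain ⟨n, hn⟩ := (h₁.union h₂).exists_notMem
  simp only [Set.mem_union, Set.mem_iUnion, Set.mem_ofPred_eq, not_or, not_exists] at hn
  exact ⟨n, hn.1, hn.2⟩

theorem TrEnv.exists_freshSess (ρ : TrEnv C Name Sid) (H : List (Fact C Name Sid)) :
    ∃ i, ρ.FreshSess H i := by
  have h₁ : (⋃ p ∈ {p | p ∈ ρ.terms}, p.svars).Finite :=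
    ρ.terms.finite_toSet.biUnion fun p _ => p.finite_svars
  have h₂ : (⋃ F ∈ {F | F ∈ H}, F.svars).Finite :=
    H.finite_toSet.biUnion fun F _ => F.finite_svars
  obtain ⟨i, hi⟩ := ((h₁.union h₂).union (SessId.finite_vars ρ.sess)).exists_notMem
  simp only [Set.mem_union, Set.mem_iUnion, Set.mem_ofPred_eq, not_or, not_exists] at hi
  exact ⟨i, hi.1.1, hi.2, hi.1.2⟩

end Substitution

/-! ### Unification -/

section Unification

variable {C : CtorSig.{u}} {Name : Type w} {Sid : Type x}

/-- `σ` is a most general solution of the problem `U`. -/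
def IsMostGeneral (U : Subst C Name Sid → Prop) (σ : Subst C Name Sid) : Prop :=
  U σ ∧ ∀ θ, U θ → ∃ δ : Subst C Name Sid, θ = δ.comp σ

theorem IsMostGeneral.congr {U V : Subst C Name Sid → Prop} {σ : Subst C Name Sid}
    (h : IsMostGeneral U σ) (hUV : ∀ τ, U τ ↔ V τ) : IsMostGeneral V σ :=
  ⟨(hUV σ).1 h.1, fun θ hθ => h.2 θ ((hUV θ).2 hθ)⟩

theorem isMostGeneral_id {U : Subst C Name Sid → Prop} (h : U .id) : IsMostGeneral U .id :=
  ⟨h, fun θ _ => ⟨θ, θ.comp_id.symm⟩⟩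

/-- Two problems are solved one after the other. -/
theorem IsMostGeneral.and {U V : Subst C Name Sid → Prop} {σ τ : Subst C Name Sid}
    (hU : ∀ σ δ : Subst C Name Sid, U σ → U (δ.comp σ)) (hσ : IsMostGeneral U σ)
    (hτ : IsMostGeneral (fun τ => V (τ.comp σ)) τ) :
    IsMostGeneral (fun θ => U θ ∧ V θ) (τ.comp σ) := by
  refine ⟨⟨hU _ _ hσ.1, hτ.1⟩, ?_⟩
  rintro θ ⟨hθU, hθV⟩
  obtain ⟨δ, rfl⟩ := hσ.2 θ hθU
  obtain ⟨ε, rfl⟩ := hτ.2 δ hθV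
  exact ⟨ε, ε.comp_assoc τ σ⟩

/-- A finite system of problems with the common solution `θ` is solvable in the most general way
as soon as each problem is, after any substitution through which `θ` factors. -/
theorem exists_isMostGeneral_forall {ι : Type*} {U : ι → Subst C Name Sid → Prop}
    (hU : ∀ i (σ δ : Subst C Name Sid), U i σ → U i (δ.comp σ)) (θ : Subst C Name Sid)
    (L : List ι) (hθ : ∀ i ∈ L, U i θ)
    (hsolve : ∀ i ∈ L, ∀ σ δ : Subst C Name Sid, δ.comp σ = θ →
      ∃ μ, IsMostGeneral (fun τ => U i (τ.comp σ)) μ) :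
    ∃ μ, IsMostGeneral (fun τ => ∀ i ∈ L, U i τ) μ := by
  induction L with
  | nil => exact ⟨.id, isMostGeneral_id (by simp)⟩
  | cons i L ih =>
    obtain ⟨σ, hσ⟩ := ih (fun j hj => hθ j (.tail _ hj)) fun j hj => hsolve j (.tail _ hj)
    obtain ⟨δ, hδ⟩ := hσ.2 θ fun j hj => hθ j (.tail _ hj)
    obtain ⟨μ, hμ⟩ := hsolve i (.head _) σ δ hδ.symm
    refine ⟨μ.comp σ, (IsMostGeneral.and ?_ hσ hμ).congr fun τ => ?_⟩
    · exact fun σ δ h j hj => hU j σ δ (h j hj)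
    · rw [List.forall_mem_cons, and_comm]

theorem exists_isMostGeneral_forall_fin {n : ℕ} {U : Fin n → Subst C Name Sid → Prop}
    (hU : ∀ i (σ δ : Subst C Name Sid), U i σ → U i (δ.comp σ)) (θ : Subst C Name Sid)
    (hθ : ∀ i, U i θ)
    (hsolve : ∀ i, ∀ σ δ : Subst C Name Sid, δ.comp σ = θ →
      ∃ μ, IsMostGeneral (fun τ => U i (τ.comp σ)) μ) :
    ∃ μ, IsMostGeneral (fun τ => ∀ i, U i τ) μ := by
  obtain ⟨μ, hμ⟩ := exists_isMostGeneral_forall hU θ (List.finRange n) (fun i _ => hθ i)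
    fun i _ => hsolve i
  exact ⟨μ, hμ.congr fun τ => by simp⟩

theorem exists_isMostGeneral_sess (s t : SessId Sid) (θ : Subst C Name Sid)
    (hθ : s.subst θ.sess = t.subst θ.sess) :
    ∃ μ : Subst C Name Sid, IsMostGeneral (fun τ => s.subst τ.sess = t.subst τ.sess) μ := by
  have hvar : ∀ (i : ℕ) (t : SessId Sid), ∃ μ : Subst C Name Sid,
      IsMostGeneral (fun τ => (SessId.var i).subst τ.sess = t.subst τ.sess) μ := by
    intro i t
    by_cases ht : t = .var i
    · subst ht
      exact ⟨.id, isMostGeneral_id rfl⟩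
    · refine ⟨⟨.var, Function.update .var i t⟩, ?_, fun θ hθ => ⟨θ, ?_⟩⟩
      · have h : t.subst (Function.update .var i t) = t.subst .var :=
          SessId.subst_congr fun k hk =>
            Function.update_of_ne (by rintro rfl; exact ht hk) _ _
        rw [SessId.subst_var] at h
        exact (Function.update_self (f := SessId.var) i t).trans h.symm
      · cases θ with
        | mk ord sess =>
        simp only [Subst.comp, Subst.mk.injEq]
        refine ⟨rfl, funext fun k => ?_⟩
        rcases eq_or_ne k i with rfl | hk
        · simpa [SessId.subst] using hθ
        · simp [Function.update_of_ne hk, SessId.subst]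
  cases s with
  | var i => exact hvar i t
  | const l =>
    cases t with
    | var i =>
      obtain ⟨μ, hμ⟩ := hvar i (.const l)
      exact ⟨μ, hμ.congr fun τ => eq_comm⟩
    | const m => exact ⟨.id, isMostGeneral_id hθ⟩

theorem exists_isMostGeneral_sessList (ids ids' : List (SessId Sid)) (θ : Subst C Name Sid)
    (hθ : ids.map (SessId.subst θ.sess) = ids'.map (SessId.subst θ.sess)) :
    ∃ μ : Subst C Name Sid, IsMostGeneral
      (fun τ => ids.map (SessId.subst τ.sess) = ids'.map (SessId.subst τ.sess)) μ := by
  have hlen : ids.length = ids'.length := by simpa using congrArg List.length hθ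
  have key : ∀ τ : Subst C Name Sid,
      (∀ i : Fin ids.length, ids[i].subst τ.sess = (ids'[i]'(hlen ▸ i.2)).subst τ.sess) ↔
        ids.map (SessId.subst τ.sess) = ids'.map (SessId.subst τ.sess) := by
    intro τ
    rw [List.ext_getElem_iff]
    simp only [List.length_map, List.getElem_map, hlen, true_and, Fin.getElem_fin]
    exact ⟨fun h k hk _ => h ⟨k, hlen ▸ hk⟩, fun h i => h i (hlen ▸ i.2) (hlen ▸ i.2)⟩
  obtain ⟨μ, hμ⟩ := exists_isMostGeneral_forall_fin
    (U := fun (i : Fin ids.length) τ =>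
      ids[i].subst τ.sess = (ids'[i]'(hlen ▸ i.2)).subst τ.sess)
    (fun i σ δ h => by
      have := congrArg (SessId.subst δ.sess) h
      rwa [SessId.subst_subst, SessId.subst_subst] at this) θ ((key θ).2 hθ)
    (fun i σ δ h => by
      obtain ⟨μ, hμ⟩ := exists_isMostGeneral_sess (C := C) (Name := Name) (ids[i].subst σ.sess)
        ((ids'[i]'(hlen ▸ i.2)).subst σ.sess) δ (by
          rw [SessId.subst_subst, SessId.subst_subst]
          have := (key θ).2 hθ i
          rwa [← h] at this)
      exact ⟨μ, hμ.congr fun τ => by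
        rw [SessId.subst_subst, SessId.subst_subst]; rfl⟩)
  exact ⟨μ, hμ.congr key⟩

/-- Number of function symbols; it serves the occurs check. -/
def Pattern.size : Pattern C Name Sid → ℕ
  | .var _ => 0
  | .name _ _ ps _ => 1 + ∑ j, (ps j).size
  | .bzero p => 1 + p.size
  | .app _ args => 1 + ∑ j, (args j).size

theorem Pattern.size_le_size_subst {p : Pattern C Name Sid} {n : ℕ} (h : n ∈ p.vars)
    (θ : Subst C Name Sid) : (θ.ord n).size ≤ (p.subst θ).size := by
  induction p with
  | var m =>
    obtain rfl : n = m := h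
    exact le_rfl
  | name a m ps ids ih =>
    obtain ⟨j, hj⟩ := Set.mem_iUnion.1 h
    exact (ih j hj).trans ((Finset.single_le_sum (f := fun j => ((ps j).subst θ).size)
      (fun _ _ => Nat.zero_le _) (Finset.mem_univ j)).trans (Nat.le_add_left _ _))
  | bzero p ih => exact (ih h).trans (Nat.le_add_left _ _)
  | app f args ih =>
    obtain ⟨j, hj⟩ := Set.mem_iUnion.1 h
    exact (ih j hj).trans ((Finset.single_le_sum (f := fun j => ((args j).subst θ).size)
      (fun _ _ => Nat.zero_le _) (Finset.mem_univ j)).trans (Nat.le_add_left _ _))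

/-- The occurs check. -/
theorem Pattern.eq_var_of_subst_eq {p : Pattern C Name Sid} {n : ℕ} (h : n ∈ p.vars)
    {θ : Subst C Name Sid} (hθ : θ.ord n = p.subst θ) : p = .var n := by
  have hlt : ∀ {m : ℕ} (args : Fin m → Pattern C Name Sid), n ∈ ⋃ j, (args j).vars →
      (θ.ord n).size < 1 + ∑ j, ((args j).subst θ).size := by
    intro m args h
    obtain ⟨j, hj⟩ := Set.mem_iUnion.1 h
    have h₁ := Pattern.size_le_size_subst hj θ
    have h₂ := Finset.single_le_sum (f := fun j => ((args j).subst θ).size)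
      (fun _ _ => Nat.zero_le _) (Finset.mem_univ j)
    omega
  cases p with
  | var m => exact congrArg _ (Eq.symm h)
  | name a m ps ids =>
    have := hlt ps h
    rw [hθ] at this
    exact absurd this (lt_irrefl _)
  | bzero p =>
    have := Pattern.size_le_size_subst (p := p) h θ
    rw [hθ] at this
    simp only [Pattern.subst, Pattern.size] at this
    omega
  | app f args =>
    have := hlt args h
    rw [hθ] at this
    exact absurd this (lt_irrefl _)

theorem exists_isMostGeneral_var (n : ℕ) (p : Pattern C Name Sid) (θ : Subst C Name Sid)
    (hθ : θ.ord n = p.subst θ) :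
    ∃ μ, IsMostGeneral (fun τ => (Pattern.var n).subst τ = p.subst τ) μ := by
  by_cases hp : p = .var n
  · subst hp
    exact ⟨.id, isMostGeneral_id rfl⟩
  · have hn : n ∉ p.vars := fun h => hp (Pattern.eq_var_of_subst_eq h hθ)
    refine ⟨⟨Function.update .var n p, .var⟩, ?_, fun θ hθ => ⟨θ, ?_⟩⟩
    · have h : p.subst ⟨Function.update .var n p, .var⟩ = p.subst .id :=
        Pattern.subst_congr (fun k hk => Function.update_of_ne (by rintro rfl; exact hn hk) _ _)
          fun _ _ => rfl
      rw [Pattern.subst_id] at h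
      exact (Function.update_self (f := Pattern.var) n p).trans h.symm
    · cases θ with
      | mk ord sess =>
      simp only [Subst.comp, Subst.mk.injEq]
      refine ⟨funext fun k => ?_, rfl⟩
      rcases eq_or_ne k n with rfl | hk
      · simpa [Pattern.subst] using hθ
      · simp [Function.update_of_ne hk, Pattern.subst]

/-- Systems of equations `pⱼ = qⱼ` with the common solution `θ`, given that the patterns that have
one of the common instances `pⱼθ` are unifiable in the most general way. -/
theorem exists_isMostGeneral_args {n : ℕ} {ps qs : Fin n → Pattern C Name Sid}
    (θ : Subst C Name Sid) (hθ : ∀ j, (ps j).subst θ = (qs j).subst θ)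
    (ih : ∀ j (p q : Pattern C Name Sid) (δ : Subst C Name Sid),
      p.subst δ = (ps j).subst θ → q.subst δ = (ps j).subst θ →
        ∃ μ, IsMostGeneral (fun τ => p.subst τ = q.subst τ) μ) :
    ∃ μ, IsMostGeneral (fun τ => ∀ j, (ps j).subst τ = (qs j).subst τ) μ := by
  refine exists_isMostGeneral_forall_fin (fun i σ δ h => ?_) θ hθ ?_
  · rw [← Pattern.subst_subst, ← Pattern.subst_subst, h]
  · rintro j σ δ rfl
    obtain ⟨μ, hμ⟩ := ih j ((ps j).subst σ) ((qs j).subst σ) δ (Pattern.subst_subst _ _ _)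
      ((Pattern.subst_subst _ _ _).trans (hθ j).symm)
    refine ⟨μ, hμ.congr fun τ => ?_⟩
    rw [Pattern.subst_subst, Pattern.subst_subst]

/-- Unifiable patterns have a most general unifier. The induction is on the common instance `t`,
which does not change when the equations on the arguments are solved one after the other. -/
theorem exists_isMostGeneral_of_subst_eq (t : Pattern C Name Sid) :
    ∀ (p q : Pattern C Name Sid) (θ : Subst C Name Sid),
      p.subst θ = t → q.subst θ = t →
        ∃ μ, IsMostGeneral (fun τ => p.subst τ = q.subst τ) μ := by
  have hvar : ∀ (n : ℕ) (p : Pattern C Name Sid) (θ : Subst C Name Sid),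
      θ.ord n = p.subst θ →
        ∃ μ, IsMostGeneral (fun τ => p.subst τ = (Pattern.var n).subst τ) μ := by
    intro n p θ h
    obtain ⟨μ, hμ⟩ := exists_isMostGeneral_var n p θ h
    exact ⟨μ, hμ.congr fun τ => eq_comm⟩
  induction t with
  | var n =>
    intro p q θ hp hq
    cases p with
    | var m => exact exists_isMostGeneral_var m q θ (hp.trans hq.symm)
    | name a m ps ids => cases hp
    | bzero p => cases hp
    | app f args => cases hp
  | name a n ts tids ih =>
    intro p q θ hp hq
    cases p with
    | var m => exact exists_isMostGeneral_var m q θ (hp.trans hq.symm)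
    | bzero p => cases hp
    | app f args => cases hp
    | name a m ps ids =>
      cases q with
      | var k => exact hvar k _ θ (hq.trans hp.symm)
      | bzero p => cases hq
      | app f args => cases hq
      | name b k qs ids' =>
        cases hp
        simp only [Pattern.subst, Pattern.name.injEq] at hq
        obtain ⟨rfl, rfl, hargs, hids⟩ := hq
        have hargs := eq_of_heq hargs
        obtain ⟨σ, hσ⟩ := exists_isMostGeneral_args θ (fun j => (congrFun hargs j).symm) ih
        obtain ⟨δ, rfl⟩ := hσ.2 θ fun j => (congrFun hargs j).symm
        have hmap : ∀ (l : List (SessId Sid)) (σ δ : Subst C Name Sid),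
            (l.map (SessId.subst σ.sess)).map (SessId.subst δ.sess) =
              l.map (SessId.subst (δ.comp σ).sess) := by
          intro l σ δ
          rw [List.map_map]
          exact List.map_congr_left fun s _ => s.subst_subst _ _
        obtain ⟨μ, hμ⟩ := exists_isMostGeneral_sessList (C := C) (Name := Name)
          (ids.map (SessId.subst σ.sess)) (ids'.map (SessId.subst σ.sess)) δ
          (by rw [hmap, hmap, hids])
        refine ⟨μ.comp σ, (IsMostGeneral.and
          (V := fun τ => ids.map (SessId.subst τ.sess) = ids'.map (SessId.subst τ.sess))
          (fun σ δ h j => ?_) hσ (hμ.congr fun τ => by rw [hmap, hmap])).congr fun τ => ?_⟩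
        · rw [← Pattern.subst_subst, ← Pattern.subst_subst, h]
        · simp [Pattern.subst, funext_iff]
  | bzero t ih =>
    intro p q θ hp hq
    cases p with
    | var m => exact exists_isMostGeneral_var m q θ (hp.trans hq.symm)
    | name a m ps ids => cases hp
    | app f args => cases hp
    | bzero p =>
      cases q with
      | var k => exact hvar k _ θ (hq.trans hp.symm)
      | name a m ps ids => cases hq
      | app f args => cases hq
      | bzero q =>
        obtain ⟨μ, hμ⟩ := ih p q θ (Pattern.bzero.inj hp) (Pattern.bzero.inj hq)
        exact ⟨μ, hμ.congr fun τ => by simp [Pattern.subst]⟩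
  | app f ts ih =>
    intro p q θ hp hq
    cases p with
    | var m => exact exists_isMostGeneral_var m q θ (hp.trans hq.symm)
    | name a m ps ids => cases hp
    | bzero p => cases hp
    | app f ps =>
      cases q with
      | var k => exact hvar k _ θ (hq.trans hp.symm)
      | name a m ps ids => cases hq
      | bzero p => cases hq
      | app g qs =>
        cases hp
        simp only [Pattern.subst, Pattern.app.injEq] at hq
        obtain ⟨rfl, hargs⟩ := hq
        have hargs := eq_of_heq hargs
        obtain ⟨σ, hσ⟩ := exists_isMostGeneral_args θ (fun j => (congrFun hargs j).symm) ih
        exact ⟨σ, hσ.congr fun τ => by simp [Pattern.subst, funext_iff]⟩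

theorem exists_isMGU {p q : Pattern C Name Sid} {θ : Subst C Name Sid}
    (h : p.subst θ = q.subst θ) : ∃ μ, IsMGU p q μ :=
  exists_isMostGeneral_of_subst_eq _ p q θ rfl h.symm

/-- Matchable pairs have a most general pair of substitutions: it comes from a most general
unifier once the variables of the patterns are renamed to even numbers and the variables of the
rewrite rule to odd numbers. -/
theorem exists_isMGPair {n : ℕ} {p : Fin n → Pattern C Name Sid} {p' : Fin n → RuleTerm C}
    {θ : Subst C Name Sid} {θ' : ℕ → Pattern C Name Sid}
    (h : ∀ j, (p j).subst θ = (p' j).toPattern θ') : ∃ σ σ', IsMGPair p p' σ σ' := by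
  let even : Subst C Name Sid := ⟨fun n => .var (2 * n), .var⟩
  let odd : ℕ → Pattern C Name Sid := fun n => .var (2 * n + 1)
  let glue (θ : Subst C Name Sid) (θ' : ℕ → Pattern C Name Sid) : Subst C Name Sid :=
    ⟨fun k => if k % 2 = 0 then θ.ord (k / 2) else θ' (k / 2), θ.sess⟩
  have heven : ∀ θ θ', (glue θ θ').comp even = θ := by
    intro θ θ'
    simp [glue, even, Subst.comp, Pattern.subst, SessId.subst]
  have hodd : ∀ θ θ' n, (odd n).subst (glue θ θ') = θ' n := by
    intro θ θ' n
    have h₁ : (2 * n + 1) % 2 ≠ 0 := by omega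
    have h₂ : (2 * n + 1) / 2 = n := by omega
    simp [glue, odd, Pattern.subst, h₂]
  have hglue : ∀ θ θ', (∀ j, (p j).subst θ = (p' j).toPattern θ') →
      ∀ j, ((p j).subst even).subst (glue θ θ') = ((p' j).toPattern odd).subst (glue θ θ') := by
    intro θ θ' h j
    simp only [Pattern.subst_subst, heven, RuleTerm.toPattern_subst, hodd, h]
  obtain ⟨μ, hμ⟩ := exists_isMostGeneral_args (glue θ θ') (hglue θ θ' h)
    fun j p q δ hp hq => exists_isMGU (hp.trans hq.symm)
  refine ⟨μ.comp even, fun n => (odd n).subst μ, fun j => ?_, fun θ θ' h => ?_⟩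
  · rw [← Pattern.subst_subst, hμ.1 j, RuleTerm.toPattern_subst]
  · obtain ⟨δ, hδ⟩ := hμ.2 _ (hglue θ θ' h)
    refine ⟨δ, ?_, fun n => ?_⟩
    · rw [← Subst.comp_assoc, ← hδ, heven]
    · rw [Pattern.subst_subst, ← hδ, hodd]

end Unification

/-! ### Scoping -/

section Scoping

variable {C : CtorSig.{u}} {Sg : Signature.{u, v}} {Name : Type w} {Sid : Type x}

/-- All indices are smaller than `n` and all free names are in `D`. -/
def Term.Within (D : Set Name) (n : ℕ) : Term C Name → Prop
  | .bound k => k < n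
  | .name a => a ∈ D
  | .app _ args => ∀ j, (args j).Within D n

/-- All session indices are smaller than `m`. -/
def SessId.Within (m : ℕ) : SessId Sid → Prop
  | .var i => i < m
  | .const _ => True

/-- `Term.Within` and `SessId.Within` for the components of a label. -/
def Label.Within (D : Set Name) (n m : ℕ) : Label C Name Sid → Prop
  | .honest _ Ms ids => (∀ M ∈ Ms, M.Within D n) ∧ ∀ i ∈ ids, i.Within m
  | .adv _ ids => ∀ i ∈ ids, i.Within m

/-- All term indices are smaller than `n`, all session indices are smaller than `m`, relative to
the binders of the process, and all free names are in `D`. -/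
def IProc.Within (D : Set Name) : ℕ → ℕ → IProc Sg Name Sid → Prop
  | n, m, .output M N P => M.Within D n ∧ N.Within D n ∧ P.Within D n m
  | n, m, .input M P => M.Within D n ∧ P.Within D (n + 1) m
  | _, _, .nil => True
  | n, m, .par P Q => P.Within D n m ∧ Q.Within D n m
  | n, m, .repl P => P.Within D n (m + 1)
  | n, m, .res lab P => lab.Within D n m ∧ P.Within D (n + 1) m
  | n, m, .letDtor _ Ms P Q =>
      (∀ j, (Ms j).Within D n) ∧ P.Within D (n + 1) m ∧ Q.Within D n m
  | n, m, .cond M N P Q =>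
      M.Within D n ∧ N.Within D n ∧ P.Within D n m ∧ Q.Within D n m
  | n, m, .event M P => M.Within D n ∧ P.Within D n m

theorem Term.Within.mono {D D' : Set Name} (hD : D ⊆ D') {n n' : ℕ} (hn : n ≤ n')
    {M : Term C Name} (h : M.Within D n) : M.Within D' n' := by
  induction M with
  | bound k => exact lt_of_lt_of_le h hn
  | name a => exact hD h
  | app f args ih => exact fun j => ih j (h j)

theorem Label.Within.mono {D D' : Set Name} (hD : D ⊆ D') {n m : ℕ}
    {lab : Label C Name Sid} (h : lab.Within D n m) : lab.Within D' n m := by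
  cases lab with
  | honest a Ms ids => exact ⟨fun M hM => (h.1 M hM).mono hD le_rfl, h.2⟩
  | adv a ids => exact h

theorem IProc.Within.mono {D D' : Set Name} (hD : D ⊆ D') {P : IProc Sg Name Sid} :
    ∀ {n m : ℕ}, P.Within D n m → P.Within D' n m := by
  have ht : ∀ {n : ℕ} {M : Term Sg.toCtorSig Name}, M.Within D n → M.Within D' n :=
    fun h => h.mono hD le_rfl
  induction P with
  | output M N P ih => exact fun h => ⟨ht h.1, ht h.2.1, ih h.2.2⟩
  | input M P ih => exact fun h => ⟨ht h.1, ih h.2⟩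
  | nil => exact fun h => h
  | par P Q ihP ihQ => exact fun h => ⟨ihP h.1, ihQ h.2⟩
  | repl P ih => exact fun h => ih h
  | res lab P ih => exact fun h => ⟨h.1.mono hD, ih h.2⟩
  | letDtor g Ms P Q ihP ihQ => exact fun h => ⟨fun j => ht (h.1 j), ihP h.2.1, ihQ h.2.2⟩
  | cond M N P Q ihP ihQ => exact fun h => ⟨ht h.1, ht h.2.1, ihP h.2.2.1, ihQ h.2.2.2⟩
  | event M P ih => exact fun h => ⟨ht h.1, ih h.2⟩

theorem Term.Within.openAt {D : Set Name} {M : Term C Name} (hM : M.Within D 0) {n : ℕ}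
    {N : Term C Name} (h : N.Within D (n + 1)) : (Term.openAt M n N).Within D n := by
  induction N with
  | bound k =>
    unfold Term.openAt
    split_ifs with hk
    · exact hM.mono subset_rfl (Nat.zero_le n)
    · exact lt_of_le_of_ne (Nat.lt_succ_iff.1 h) hk
  | name a => exact h
  | app f args ih => exact fun j => ih j (h j)

theorem Label.Within.openTerm {D : Set Name} {M : Term C Name} (hM : M.Within D 0) {n m : ℕ}
    {lab : Label C Name Sid} (h : lab.Within D (n + 1) m) :
    (lab.openTerm M n).Within D n m := by
  cases lab with
  | honest a Ms ids =>
    refine ⟨fun N hN => ?_, h.2⟩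
    obtain ⟨N', hN', rfl⟩ := List.mem_map.1 hN
    exact Term.Within.openAt hM (h.1 N' hN')
  | adv a ids => exact h

theorem IProc.Within.openTerm {D : Set Name} {M : Term Sg.toCtorSig Name} (hM : M.Within D 0)
    {P : IProc Sg Name Sid} :
    ∀ {n m : ℕ}, P.Within D (n + 1) m → (P.openTerm M n).Within D n m := by
  have ht : ∀ {n : ℕ} {N : Term Sg.toCtorSig Name}, N.Within D (n + 1) →
      (Term.openAt M n N).Within D n := fun h => hM.openAt h
  induction P with
  | output M N P ih => exact fun h => ⟨ht h.1, ht h.2.1, ih h.2.2⟩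
  | input M P ih => exact fun h => ⟨ht h.1, ih h.2⟩
  | nil => exact fun h => h
  | par P Q ihP ihQ => exact fun h => ⟨ihP h.1, ihQ h.2⟩
  | repl P ih => exact fun h => ih h
  | res lab P ih => exact fun h => ⟨Label.Within.openTerm hM h.1, ih h.2⟩
  | letDtor g Ms P Q ihP ihQ => exact fun h => ⟨fun j => ht (h.1 j), ihP h.2.1, ihQ h.2.2⟩
  | cond M N P Q ihP ihQ => exact fun h => ⟨ht h.1, ht h.2.1, ihP h.2.2.1, ihQ h.2.2.2⟩
  | event M P ih => exact fun h => ⟨ht h.1, ih h.2⟩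

theorem SessId.Within.openAt {l : Sid} {m : ℕ} {s : SessId Sid} (h : s.Within (m + 1)) :
    (s.openAt l m).Within m := by
  cases s with
  | var k =>
    simp only [SessId.openAt]
    split_ifs with hk
    · trivial
    · exact lt_of_le_of_ne (Nat.lt_succ_iff.1 h) hk
  | const l => trivial

theorem Label.Within.openSess {D : Set Name} {l : Sid} {n m : ℕ}
    {lab : Label C Name Sid} (h : lab.Within D n (m + 1)) :
    (lab.openSess l m).Within D n m := by
  have hids : ∀ ids : List (SessId Sid), (∀ i ∈ ids, i.Within (m + 1)) →
      ∀ i ∈ ids.map (SessId.openAt l m), i.Within m := by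
    intro ids h i hi
    obtain ⟨i', hi', rfl⟩ := List.mem_map.1 hi
    exact (h i' hi').openAt
  cases lab with
  | honest a Ms ids => exact ⟨h.1, hids ids h.2⟩
  | adv a ids => exact hids ids h

theorem IProc.Within.openSess {D : Set Name} {l : Sid} {P : IProc Sg Name Sid} :
    ∀ {n m : ℕ}, P.Within D n (m + 1) → (P.openSess l m).Within D n m := by
  induction P with
  | output M N P ih => exact fun h => ⟨h.1, h.2.1, ih h.2.2⟩
  | input M P ih => exact fun h => ⟨h.1, ih h.2⟩
  | nil => exact fun h => h
  | par P Q ihP ihQ => exact fun h => ⟨ihP h.1, ihQ h.2⟩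
  | repl P ih => exact fun h => ih h
  | res lab P ih => exact fun h => ⟨h.1.openSess, ih h.2⟩
  | letDtor g Ms P Q ihP ihQ => exact fun h => ⟨h.1, ihP h.2.1, ihQ h.2.2⟩
  | cond M N P Q ihP ihQ => exact fun h => ⟨h.1, h.2.1, ihP h.2.2.1, ihQ h.2.2.2⟩
  | event M P ih => exact fun h => ⟨h.1, ih h.2⟩

theorem Term.Scoped.within {n : ℕ} {M : Term C Name} (h : M.Scoped n) {D : Set Name}
    (hD : M.fn ⊆ D) : M.Within D n := by
  induction M with
  | bound k => exact h
  | name a => exact hD rfl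
  | app f args ih =>
    exact fun j => ih j (h j) ((Set.subset_iUnion (fun j => (args j).fn) j).trans hD)

theorem RuleTerm.within_of_toTerm {D : Set Name} {n : ℕ} {σ : ℕ → Term C Name}
    {r : RuleTerm C} (h : (r.toTerm σ).Within D n) : ∀ k ∈ r.vars, (σ k).Within D n := by
  induction r with
  | var k =>
    rintro _ rfl
    exact h
  | app f args ih =>
    intro k hk
    obtain ⟨j, hj⟩ := Set.mem_iUnion.1 hk
    exact ih j (h j) k hj

theorem RuleTerm.within_toTerm {D : Set Name} {n : ℕ} {σ : ℕ → Term C Name}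
    {r : RuleTerm C} (h : ∀ k ∈ r.vars, (σ k).Within D n) : (r.toTerm σ).Within D n := by
  induction r with
  | var k => exact h k rfl
  | app f args ih => exact fun j => ih j fun k hk => h k (Set.mem_iUnion.2 ⟨j, hk⟩)

theorem Reduces.within {D : Set Name} {n : ℕ} {g : Sg.Dtor}
    {Ms : Fin (Sg.dtorArity g) → Term Sg.toCtorSig Name} {M : Term Sg.toCtorSig Name}
    (h : Reduces Sg g Ms M) (hMs : ∀ j, (Ms j).Within D n) : M.Within D n := by
  obtain ⟨r, -, σ, hlhs, rfl⟩ := h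
  refine RuleTerm.within_toTerm fun k hk => ?_
  obtain ⟨j, hj⟩ := Set.mem_iUnion.1 (r.vars_rhs hk)
  exact RuleTerm.within_of_toTerm (hlhs j ▸ hMs j) k hj

theorem lt_of_mem_map_succ_append {t : List ℕ} {n : ℕ} (ht : ∀ k ∈ t, k < n) {t' : List ℕ}
    (ht' : ∀ k ∈ t', k = 0) : ∀ k ∈ t.map (· + 1) ++ t', k < n + 1 := by
  intro k hk
  rcases List.mem_append.1 hk with hk | hk
  · obtain ⟨k', hk', rfl⟩ := List.mem_map.1 hk
    exact Nat.succ_lt_succ (ht k' hk')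
  · rw [ht' k hk]
    exact n.succ_pos

theorem Proc.within_instrAux {D : Set Name} {P : Proc Sg Name} : ∀ {t s : List ℕ} {n m : ℕ},
    P.Scoped n → (instrAux Sid t s P).fn ⊆ D → (∀ k ∈ t, k < n) → (∀ k ∈ s, k < m) →
    (instrAux Sid t s P).Within D n m := by
  induction P with
  | output M N P ih =>
    intro t s n m h hD ht hs
    simp only [instrAux, IProc.fn, Set.union_subset_iff] at hD
    exact ⟨h.1.within hD.1.1, h.2.1.within hD.1.2, ih h.2.2 hD.2 ht hs⟩
  | input M P ih =>
    intro t s n m h hD ht hs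
    simp only [instrAux, IProc.fn, Set.union_subset_iff] at hD
    exact ⟨h.1.within hD.1, ih h.2 hD.2 (lt_of_mem_map_succ_append ht (by simp)) hs⟩
  | nil => exact fun _ _ _ _ => trivial
  | par P Q ihP ihQ =>
    intro t s n m h hD ht hs
    simp only [instrAux, IProc.fn, Set.union_subset_iff] at hD
    exact ⟨ihP h.1 hD.1 ht hs, ihQ h.2 hD.2 ht hs⟩
  | repl P ih =>
    intro t s n m h hD ht hs
    exact ih h hD ht (lt_of_mem_map_succ_append hs (by simp))
  | res a P ih =>
    intro t s n m h hD ht hs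
    simp only [instrAux, IProc.fn, Set.union_subset_iff] at hD
    refine ⟨⟨fun M hM => ?_, fun i hi => ?_⟩, ih h hD.2 ?_ hs⟩
    · obtain ⟨k, hk, rfl⟩ := List.mem_map.1 hM
      exact ht k hk
    · obtain ⟨k, hk, rfl⟩ := List.mem_map.1 hi
      exact hs k hk
    · simpa using lt_of_mem_map_succ_append ht (t' := []) (by simp)
  | letDtor g Ms P Q ihP ihQ =>
    intro t s n m h hD ht hs
    simp only [instrAux, IProc.fn, Set.union_subset_iff, Set.iUnion_subset_iff] at hD
    refine ⟨fun j => (h.1 j).within (hD.1.1 j), ihP h.2.1 hD.1.2 ?_ hs, ihQ h.2.2 hD.2 ht hs⟩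
    refine lt_of_mem_map_succ_append ht fun k hk => ?_
    split_ifs at hk
    · simpa using hk
    · simp at hk
  | cond M N P Q ihP ihQ =>
    intro t s n m h hD ht hs
    simp only [instrAux, IProc.fn, Set.union_subset_iff] at hD
    exact ⟨h.1.within hD.1.1.1, h.2.1.within hD.1.1.2, ihP h.2.2.1 hD.1.2 ht hs,
      ihQ h.2.2.2 hD.2 ht hs⟩
  | event M P ih =>
    intro t s n m h hD ht hs
    simp only [instrAux, IProc.fn, Set.union_subset_iff] at hD
    exact ⟨h.1.within hD.1, ih h.2 hD.2 ht hs⟩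

theorem Proc.within_instrAdvAux {D : Set Name} {P : Proc Sg Name} : ∀ {s : List ℕ} {n m : ℕ},
    P.Scoped n → P.fn ⊆ D → (∀ k ∈ s, k < m) → (instrAdvAux Sid s P).Within D n m := by
  induction P with
  | output M N P ih =>
    intro s n m h hD hs
    simp only [Proc.fn, Set.union_subset_iff] at hD
    exact ⟨h.1.within hD.1.1, h.2.1.within hD.1.2, ih h.2.2 hD.2 hs⟩
  | input M P ih =>
    intro s n m h hD hs
    simp only [Proc.fn, Set.union_subset_iff] at hD
    exact ⟨h.1.within hD.1, ih h.2 hD.2 hs⟩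
  | nil => exact fun _ _ _ => trivial
  | par P Q ihP ihQ =>
    intro s n m h hD hs
    simp only [Proc.fn, Set.union_subset_iff] at hD
    exact ⟨ihP h.1 hD.1 hs, ihQ h.2 hD.2 hs⟩
  | repl P ih =>
    intro s n m h hD hs
    exact ih h hD (lt_of_mem_map_succ_append hs (by simp))
  | res a P ih =>
    intro s n m h hD hs
    refine ⟨fun i hi => ?_, ih h hD hs⟩
    obtain ⟨k, hk, rfl⟩ := List.mem_map.1 hi
    exact hs k hk
  | letDtor g Ms P Q ihP ihQ =>
    intro s n m h hD hs
    simp only [Proc.fn, Set.union_subset_iff, Set.iUnion_subset_iff] at hD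
    exact ⟨fun j => (h.1 j).within (hD.1.1 j), ihP h.2.1 hD.1.2 hs, ihQ h.2.2 hD.2 hs⟩
  | cond M N P Q ihP ihQ =>
    intro s n m h hD hs
    simp only [Proc.fn, Set.union_subset_iff] at hD
    exact ⟨h.1.within hD.1.1.1, h.2.1.within hD.1.1.2, ihP h.2.2.1 hD.1.2 hs,
      ihQ h.2.2.2 hD.2 hs⟩
  | event M P ih =>
    intro s n m h hD hs
    simp only [Proc.fn, Set.union_subset_iff] at hD
    exact ⟨h.1.within hD.1, ih h.2 hD.2 hs⟩

end Scoping

/-! ### Valuations -/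

section Valuation

variable {C : CtorSig.{u}} {Sg : Signature.{u, v}} {Name : Type w} {Sid : Type x}

/-- An interpretation of names, of term indices and of session indices. -/
structure Valuation (C : CtorSig.{u}) (Name : Type w) (Sid : Type x) where
  name : Name → Pattern C Name Sid
  ord : ℕ → Pattern C Name Sid
  sess : ℕ → SessId Sid

namespace Valuation

/-- The extension of `v` to terms. -/
def term (v : Valuation C Name Sid) : Term C Name → Pattern C Name Sid
  | .bound k => v.ord k
  | .name a => v.name a
  | .app f args => .app f fun j => v.term (args j)

/-- The extension of `v` to restriction labels. -/
def label (v : Valuation C Name Sid) : Label C Name Sid → Pattern C Name Sid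
  | .honest a Ms ids =>
      .name a Ms.length (fun j => v.term (Ms.get j)) (ids.map (SessId.subst v.sess))
  | .adv a ids => .bzero (.name a 0 Fin.elim0 (ids.map (SessId.subst v.sess)))

/-- The valuation below a binder of a term index. -/
def push (v : Valuation C Name Sid) (p : Pattern C Name Sid) : Valuation C Name Sid :=
  ⟨v.name, fun | 0 => p | k + 1 => v.ord k, v.sess⟩

/-- The valuation below a replication. -/
def pushSess (v : Valuation C Name Sid) (s : SessId Sid) : Valuation C Name Sid :=
  ⟨v.name, v.ord, fun | 0 => s | k + 1 => v.sess k⟩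

/-- `v` and `v'` coincide on the names of `D`, the first `n` term indices and the first `m`
session indices. -/
structure Agree (D : Set Name) (n m : ℕ) (v v' : Valuation C Name Sid) : Prop where
  name : ∀ a ∈ D, v.name a = v'.name a
  ord : ∀ k < n, v.ord k = v'.ord k
  sess : ∀ k < m, v.sess k = v'.sess k

variable {D : Set Name} {n m : ℕ} {v v' : Valuation C Name Sid}

theorem Agree.push (h : Agree D n m v v') (p : Pattern C Name Sid) :
    Agree D (n + 1) m (v.push p) (v'.push p) := by
  refine ⟨h.name, fun k hk => ?_, h.sess⟩
  cases k with
  | zero => rfl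
  | succ k => exact h.ord k (Nat.lt_of_succ_lt_succ hk)

theorem Agree.pushSess (h : Agree D n m v v') (s : SessId Sid) :
    Agree D n (m + 1) (v.pushSess s) (v'.pushSess s) := by
  refine ⟨h.name, h.ord, fun k hk => ?_⟩
  cases k with
  | zero => rfl
  | succ k => exact h.sess k (Nat.lt_of_succ_lt_succ hk)

theorem Agree.term (h : Agree D n m v v') {M : Term C Name} (hM : M.Within D n) :
    v.term M = v'.term M := by
  induction M with
  | bound k => exact h.ord k hM
  | name a => exact h.name a hM
  | app f args ih => simp only [Valuation.term, ih _ (hM _)]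

theorem Agree.label (h : Agree D n m v v') {lab : Label C Name Sid} (hl : lab.Within D n m) :
    v.label lab = v'.label lab := by
  have hids : ∀ ids : List (SessId Sid), (∀ i ∈ ids, i.Within m) →
      ids.map (SessId.subst v.sess) = ids.map (SessId.subst v'.sess) := fun ids hi =>
    List.map_congr_left fun i him => SessId.subst_congr fun k hk => h.sess k (by
      have := hi i him
      rwa [hk] at this)
  cases lab with
  | honest a Ms ids =>
    simp only [Valuation.label, hids ids hl.2]
    congr 1
    exact funext fun j => h.term (hl.1 _ (List.get_mem _ _))
  | adv a ids => simp only [Valuation.label, hids ids hl]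

theorem term_openAt {M : Term C Name} {k : ℕ} (h : v.ord k = v.term M) (N : Term C Name) :
    v.term (Term.openAt M k N) = v.term N := by
  induction N with
  | bound j =>
    unfold Term.openAt
    split_ifs with hj
    · rw [hj, ← h]
      rfl
    · rfl
  | name a => rfl
  | app f args ih => simp only [Term.openAt, Valuation.term, ih]

theorem label_openTerm {M : Term C Name} {k : ℕ} (h : v.ord k = v.term M)
    (lab : Label C Name Sid) : v.label (lab.openTerm M k) = v.label lab := by
  cases lab with
  | honest a Ms ids =>
    -- the number of arguments changes up to a propositional equality only
    have hcongr : ∀ {n n' : ℕ} {ps : Fin n → Pattern C Name Sid}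
        {qs : Fin n' → Pattern C Name Sid} (ids : List (SessId Sid)),
        List.ofFn ps = List.ofFn qs → Pattern.name a n ps ids = .name a n' qs ids := by
      intro n n' ps qs ids h
      have hs := List.ofFn_inj'.1 h
      simp only [Sigma.mk.injEq] at hs
      obtain ⟨rfl, hpq⟩ := hs
      rw [eq_of_heq hpq]
    refine hcongr _ (List.ext_getElem (by simp) fun j _ _ => ?_)
    simp [term_openAt h]
  | adv a ids => rfl

theorem label_openSess {l : Sid} {k : ℕ} (h : v.sess k = .const l) (lab : Label C Name Sid) :
    v.label (lab.openSess l k) = v.label lab := by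
  have hids : ∀ ids : List (SessId Sid),
      (ids.map (SessId.openAt l k)).map (SessId.subst v.sess) =
        ids.map (SessId.subst v.sess) := by
    intro ids
    rw [List.map_map]
    refine List.map_congr_left fun i _ => ?_
    cases i with
    | var j =>
      simp only [Function.comp, SessId.openAt]
      split_ifs with hj
      · rw [hj]
        exact h.symm
      · rfl
    | const => rfl
  cases lab <;> simp only [Label.openSess, Valuation.label, hids]

theorem term_toTerm (σ : ℕ → Term C Name) (r : RuleTerm C) :
    v.term (r.toTerm σ) = r.toPattern fun k => v.term (σ k) := by
  induction r with
  | var k => rfl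
  | app f args ih => simp only [RuleTerm.toTerm, Valuation.term, RuleTerm.toPattern, ih]

end Valuation

/-- The environment `E` as a valuation, which leaves the variables unchanged. -/
def Env.valuation (E : Env C Name Sid) : Valuation C Name Sid := ⟨E.map, .var, .var⟩

theorem Env.valuation_term (E : Env C Name Sid) (M : Term C Name) :
    E.valuation.term M = E.term M := by
  induction M with
  | bound k => rfl
  | name a => rfl
  | app f args ih => simp only [Valuation.term, Env.term, ih]

theorem Env.valuation_label (E : Env C Name Sid) (lab : Label C Name Sid) :
    E.valuation.label lab = E.label lab := by
  have hids : ∀ ids : List (SessId Sid), ids.map (SessId.subst E.valuation.sess) = ids :=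
    fun ids => (List.map_congr_left fun s _ => s.subst_var).trans (List.map_id _)
  cases lab <;> simp only [Valuation.label, Env.label, hids, Env.valuation_term]

/-! ### Facts with closed patterns -/

/-- No variables of either sort. -/
def Pattern.Closed (p : Pattern C Name Sid) : Prop := p.vars = ∅ ∧ p.svars = ∅

theorem Pattern.closed_app {f : C.Ctor} {args : Fin (C.ctorArity f) → Pattern C Name Sid} :
    (Pattern.app f args).Closed ↔ ∀ j, (args j).Closed := by
  simp only [Pattern.Closed, Pattern.vars, Pattern.svars, Set.iUnion_eq_empty, forall_and]

theorem Pattern.closed_bzero {p : Pattern C Name Sid} : p.bzero.Closed ↔ p.Closed := Iff.rfl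

theorem Pattern.Closed.name {a : Name} {n : ℕ} {ps : Fin n → Pattern C Name Sid}
    {ids : List (SessId Sid)} (hps : ∀ j, (ps j).Closed) (hids : ∀ i ∈ ids, i.Within 0) :
    (Pattern.name a n ps ids).Closed := by
  refine ⟨Set.iUnion_eq_empty.2 fun j => (hps j).1, ?_⟩
  refine Set.union_empty_iff.2 ⟨Set.iUnion_eq_empty.2 fun j => (hps j).2, ?_⟩
  exact Set.eq_empty_of_forall_notMem fun i hi => Nat.not_lt_zero i (hids _ hi)

theorem Pattern.closed_free (a : Name) : (Pattern.free a : Pattern C Name Sid).Closed :=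
  .name (fun j => j.elim0) (by simp)

theorem RuleTerm.closed_of_toPattern {σ : ℕ → Pattern C Name Sid} {r : RuleTerm C}
    (h : (r.toPattern σ).Closed) : ∀ k ∈ r.vars, (σ k).Closed := by
  induction r with
  | var k =>
    rintro _ rfl
    exact h
  | app f args ih =>
    intro k hk
    obtain ⟨j, hj⟩ := Set.mem_iUnion.1 hk
    exact ih j (Pattern.closed_app.1 h j) k hj

theorem RuleTerm.closed_toPattern {σ : ℕ → Pattern C Name Sid} {r : RuleTerm C}
    (h : ∀ k ∈ r.vars, (σ k).Closed) : (r.toPattern σ).Closed := by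
  induction r with
  | var k => exact h k rfl
  | app f args ih =>
    exact Pattern.closed_app.2 fun j => ih j fun k hk => h k (Set.mem_iUnion.2 ⟨j, hk⟩)

theorem RewriteRule.closed_rhs {n : ℕ} (r : RewriteRule C n) {σ : ℕ → Pattern C Name Sid}
    (h : ∀ j, ((r.lhs j).toPattern σ).Closed) : (r.rhs.toPattern σ).Closed := by
  refine RuleTerm.closed_toPattern fun k hk => ?_
  obtain ⟨j, hj⟩ := Set.mem_iUnion.1 (r.vars_rhs hk)
  exact RuleTerm.closed_of_toPattern (h j) k hj

theorem Fact.closed_message {p q : Pattern C Name Sid} :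
    (Fact.message p q).Closed ↔ p.Closed ∧ q.Closed := by
  simp only [Fact.Closed, Fact.vars, Fact.svars, Set.union_empty_iff, Pattern.Closed]
  tauto

theorem Derivable.closed {R : Set (Clause C Name Sid)} {F : Fact C Name Sid}
    (h : Derivable R F) : F.Closed := by
  cases h with
  | intro cl hcl σ hclosed hyps => exact hclosed

/-- The patterns of the first `n` term indices are closed, those of the first `m` session indices
are constants, and names are interpreted by closed patterns. -/
structure Valuation.Ground (n m : ℕ) (v : Valuation C Name Sid) : Prop where
  name : ∀ a, (v.name a).Closed
  ord : ∀ k < n, (v.ord k).Closed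
  sess : ∀ k < m, (v.sess k).Within 0

namespace Valuation.Ground

variable {n m : ℕ} {v : Valuation C Name Sid} {D : Set Name}

theorem push (h : v.Ground n m) {p : Pattern C Name Sid} (hp : p.Closed) :
    (v.push p).Ground (n + 1) m := by
  refine ⟨h.name, fun k hk => ?_, h.sess⟩
  cases k with
  | zero => exact hp
  | succ k => exact h.ord k (Nat.lt_of_succ_lt_succ hk)

theorem pushSess (h : v.Ground n m) (l : Sid) : (v.pushSess (.const l)).Ground n (m + 1) := by
  refine ⟨h.name, h.ord, fun k hk => ?_⟩
  cases k with
  | zero => trivial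
  | succ k => exact h.sess k (Nat.lt_of_succ_lt_succ hk)

theorem term (h : v.Ground n m) {M : Term C Name} (hM : M.Within D n) :
    (v.term M).Closed := by
  induction M with
  | bound k => exact h.ord k hM
  | name a => exact h.name a
  | app f args ih => exact Pattern.closed_app.2 fun j => ih j (hM j)

theorem ids (h : v.Ground n m) {ids : List (SessId Sid)} (hids : ∀ i ∈ ids, i.Within m) :
    ∀ i ∈ ids.map (SessId.subst v.sess), i.Within 0 := by
  intro i hi
  obtain ⟨i', hi', rfl⟩ := List.mem_map.1 hi
  have := hids i' hi'
  cases i' with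
  | var k => exact h.sess k this
  | const l => trivial

theorem label (h : v.Ground n m) {lab : Label C Name Sid} (hl : lab.Within D n m) :
    (v.label lab).Closed := by
  cases lab with
  | honest a Ms ids => exact .name (fun j => h.term (hl.1 _ (List.get_mem _ _))) (h.ids hl.2)
  | adv a ids => exact Pattern.closed_bzero.2 (.name (fun j => j.elim0) (h.ids hl))

end Valuation.Ground

end Valuation

/-! ### Typed processes -/

section Typing

variable {Sg : Signature.{u, v}} {Name : Type w} {Sid : Type x}
  {R : Set (Clause Sg.toCtorSig Name Sid)}

/-- `P` is well-typed for the valuation `v`: every fact that `P` may contribute to a trace is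
derivable from `R`. The inputs range over all messages that `R` makes possible, destructors are
evaluated on patterns, the continuation of an event may assume that `R` grants this event, and the
`else` branches are always taken to be reachable. -/
def IProc.Typed (R : Set (Clause Sg.toCtorSig Name Sid)) :
    Valuation Sg.toCtorSig Name Sid → IProc Sg Name Sid → Prop
  | v, .output M N P => Derivable R (.message (v.term M) (v.term N)) ∧ P.Typed R v
  | v, .input M P =>
      ∀ p, Derivable R (.message (v.term M) p) → P.Typed R (v.push p)
  | _, .nil => True
  | v, .par P Q => P.Typed R v ∧ Q.Typed R v
  | v, .repl P => ∀ l : Sid, P.Typed R (v.pushSess (.const l))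
  | v, .res lab P => P.Typed R (v.push (v.label lab))
  | v, .letDtor g Ms P Q =>
      (∀ r ∈ Sg.rules g, ∀ σ : ℕ → Pattern Sg.toCtorSig Name Sid,
        (∀ j, v.term (Ms j) = (r.lhs j).toPattern σ) →
          P.Typed R (v.push (r.rhs.toPattern σ))) ∧
      Q.Typed R v
  | v, .cond M N P Q => (v.term M = v.term N → P.Typed R v) ∧ Q.Typed R v
  | v, .event M P =>
      Derivable R (.event (v.term M)) ∧ (Derivable R (.mevent (v.term M)) → P.Typed R v)

theorem IProc.Typed.congr {D : Set Name} {P : IProc Sg Name Sid} :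
    ∀ {n m : ℕ} {v v' : Valuation Sg.toCtorSig Name Sid}, v.Agree D n m v' →
      P.Within D n m → P.Typed R v → P.Typed R v' := by
  induction P with
  | output M N P ih =>
    intro n m v v' ha hw h
    refine ⟨?_, ih ha hw.2.2 h.2⟩
    rw [← ha.term hw.1, ← ha.term hw.2.1]
    exact h.1
  | input M P ih =>
    intro n m v v' ha hw h p hp
    rw [← ha.term hw.1] at hp
    exact ih (ha.push p) hw.2 (h p hp)
  | nil => exact fun _ _ _ => trivial
  | par P Q ihP ihQ =>
    intro n m v v' ha hw h
    exact ⟨ihP ha hw.1 h.1, ihQ ha hw.2 h.2⟩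
  | repl P ih =>
    intro n m v v' ha hw h l
    exact ih (ha.pushSess (.const l)) hw (h l)
  | res lab P ih =>
    intro n m v v' ha hw h
    have := ih (ha.push (v.label lab)) hw.2 h
    rwa [ha.label hw.1] at this
  | letDtor g Ms P Q ihP ihQ =>
    intro n m v v' ha hw h
    refine ⟨fun r hr σ hσ => ?_, ihQ ha hw.2.2 h.2⟩
    exact ihP (ha.push _) hw.2.1 (h.1 r hr σ fun j => (ha.term (hw.1 j)).trans (hσ j))
  | cond M N P Q ihP ihQ =>
    intro n m v v' ha hw h
    refine ⟨fun hMN => ihP ha hw.2.2.1 (h.1 ?_), ihQ ha hw.2.2.2 h.2⟩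
    rw [ha.term hw.1, ha.term hw.2.1, hMN]
  | event M P ih =>
    intro n m v v' ha hw h
    have hM := ha.term hw.1
    exact ⟨hM ▸ h.1, fun hm => ih ha hw.2 (h.2 (hM ▸ hm))⟩

/-- The index `k` may be replaced by a term with the same interpretation. As the valuation changes
below binders while its values on names do not, `M` is required to have the interpretation `p` in
all valuations with these values, which amounts to `M` being closed. -/
theorem IProc.Typed.openTerm {M : Term Sg.toCtorSig Name} {p : Pattern Sg.toCtorSig Name Sid}
    {e : Name → Pattern Sg.toCtorSig Name Sid}
    (hM : ∀ v : Valuation Sg.toCtorSig Name Sid, v.name = e → v.term M = p)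
    {P : IProc Sg Name Sid} :
    ∀ {k : ℕ} {v : Valuation Sg.toCtorSig Name Sid}, v.name = e → v.ord k = p →
      P.Typed R v → (P.openTerm M k).Typed R v := by
  have ht : ∀ {k : ℕ} {v : Valuation Sg.toCtorSig Name Sid}, v.name = e → v.ord k = p →
      ∀ N, v.term (Term.openAt M k N) = v.term N := fun he hk N =>
    Valuation.term_openAt (hk.trans (hM _ he).symm) N
  induction P with
  | output N N' P ih =>
    intro k v he hk h
    refine ⟨?_, ih he hk h.2⟩
    rw [ht he hk, ht he hk]
    exact h.1
  | input N P ih =>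
    intro k v he hk h q hq
    rw [ht he hk] at hq
    exact ih (v := v.push q) he hk (h q hq)
  | nil => exact fun _ _ _ => trivial
  | par P Q ihP ihQ => exact fun he hk h => ⟨ihP he hk h.1, ihQ he hk h.2⟩
  | repl P ih =>
    intro k v he hk h l
    exact ih (v := v.pushSess (.const l)) he hk (h l)
  | res lab P ih =>
    intro k v he hk h
    have := ih (k := k + 1) (v := v.push (v.label lab)) he hk h
    rwa [← Valuation.label_openTerm (hk.trans (hM _ he).symm) lab] at this
  | letDtor g Ms P Q ihP ihQ =>
    intro k v he hk h
    refine ⟨fun r hr σ hσ => ?_, ihQ he hk h.2⟩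
    exact ihP (k := k + 1) (v := v.push _) he hk
      (h.1 r hr σ fun j => (ht he hk (Ms j)).symm.trans (hσ j))
  | cond N N' P Q ihP ihQ =>
    intro k v he hk h
    refine ⟨fun hN => ihP he hk (h.1 ?_), ihQ he hk h.2⟩
    rwa [ht he hk, ht he hk] at hN
  | event N P ih =>
    intro k v he hk h
    have hN := ht he hk N
    exact ⟨hN.symm ▸ h.1, fun hm => ih he hk (h.2 (hN ▸ hm))⟩

theorem IProc.Typed.openSess {l : Sid} {P : IProc Sg Name Sid} :
    ∀ {k : ℕ} {v : Valuation Sg.toCtorSig Name Sid}, v.sess k = .const l →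
      P.Typed R v → (P.openSess l k).Typed R v := by
  induction P with
  | output N N' P ih => exact fun hk h => ⟨h.1, ih hk h.2⟩
  | input N P ih => exact fun {k v} hk h q hq => ih (v := v.push q) hk (h q hq)
  | nil => exact fun _ _ => trivial
  | par P Q ihP ihQ => exact fun hk h => ⟨ihP hk h.1, ihQ hk h.2⟩
  | repl P ih =>
    intro k v hk h l'
    exact ih (k := k + 1) (v := v.pushSess (.const l')) hk (h l')
  | res lab P ih =>
    intro k v hk h
    have := ih (v := v.push (v.label lab)) hk h
    rwa [← Valuation.label_openSess hk lab] at this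
  | letDtor g Ms P Q ihP ihQ =>
    exact fun {k v} hk h =>
      ⟨fun r hr σ hσ => ihP (v := v.push _) hk (h.1 r hr σ hσ), ihQ hk h.2⟩
  | cond N N' P Q ihP ihQ => exact fun hk h => ⟨fun hN => ihP hk (h.1 hN), ihQ hk h.2⟩
  | event N P ih => exact fun hk h => ⟨h.1, fun hm => ih hk (h.2 hm)⟩

end Typing

/-! ### Typability of the protocol -/

section Protocol

variable {Sg : Signature.{u, v}} {Name : Type w} {Sid : Type x}
  {R : Set (Clause Sg.toCtorSig Name Sid)}

theorem Derivable.of_clause {C : CtorSig.{u}} {R : Set (Clause C Name Sid)}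
    {cl : Clause C Name Sid} (hcl : cl ∈ R) (σ : Subst C Name Sid) {F : Fact C Name Sid}
    (hF : cl.concl.subst σ = F) (hclosed : F.Closed)
    (hyps : ∀ G ∈ cl.hyps, Derivable R (G.subst σ)) : Derivable R F := by
  subst hF
  exact .intro cl hcl σ hclosed hyps

/-- The instance by `θ` of the environment `ρ` of the translation is the valuation `v`, and the
instances by `θ` of the hypotheses `H` are derivable. -/
structure Realizes (R : Set (Clause Sg.toCtorSig Name Sid)) (ρ : TrEnv Sg.toCtorSig Name Sid)
    (H : List (Fact Sg.toCtorSig Name Sid)) (θ : Subst Sg.toCtorSig Name Sid)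
    (v : Valuation Sg.toCtorSig Name Sid) (n m : ℕ) : Prop where
  length_terms : ρ.terms.length = n
  length_sess : ρ.sess.length = m
  name : ∀ a, v.name a = .free a
  ord : ∀ (k : ℕ) (hk : k < ρ.terms.length), ρ.terms[k].subst θ = v.ord k
  sess : ∀ (k : ℕ) (hk : k < ρ.sess.length), ρ.sess[k].subst θ.sess = v.sess k
  hyps : ∀ F ∈ H, Derivable R (F.subst θ)

namespace Realizes

variable {ρ : TrEnv Sg.toCtorSig Name Sid} {H : List (Fact Sg.toCtorSig Name Sid)}
  {θ : Subst Sg.toCtorSig Name Sid} {v : Valuation Sg.toCtorSig Name Sid} {n m : ℕ}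
  {D : Set Name}

theorem term (h : Realizes R ρ H θ v n m) {M : Term Sg.toCtorSig Name} (hM : M.Within D n) :
    (ρ.term M).subst θ = v.term M := by
  induction M with
  | bound k =>
    have hk : k < ρ.terms.length := h.length_terms.symm ▸ hM
    simp only [TrEnv.term, List.getD_eq_getElem _ _ hk, h.ord k hk, Valuation.term]
  | name a =>
    simp only [TrEnv.term, Valuation.term, h.name, Pattern.free, Pattern.subst, List.map_nil]
    congr 1
    exact funext fun j => j.elim0
  | app f args ih => simp only [TrEnv.term, Pattern.subst, Valuation.term, ih _ (hM _)]

theorem label (h : Realizes R ρ H θ v n m) {lab : Label Sg.toCtorSig Name Sid}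
    (hl : lab.Within D n m) : (ρ.label lab).subst θ = v.label lab := by
  have hids : ∀ ids : List (SessId Sid), (∀ i ∈ ids, i.Within m) →
      (ids.map ρ.sessId).map (SessId.subst θ.sess) = ids.map (SessId.subst v.sess) := by
    intro ids hids
    rw [List.map_map]
    refine List.map_congr_left fun i hi => ?_
    have := hids i hi
    cases i with
    | var k =>
      have hk : k < ρ.sess.length := h.length_sess.symm ▸ this
      simp only [Function.comp, TrEnv.sessId, List.getD_eq_getElem _ _ hk, h.sess k hk]
      rfl
    | const l => rfl
  cases lab with
  | honest a Ms ids =>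
    simp only [TrEnv.label, Pattern.subst, Valuation.label, hids ids hl.2]
    congr 1
    exact funext fun j => h.term (hl.1 _ (List.get_mem _ _))
  | adv a ids =>
    simp only [TrEnv.label, Pattern.subst, Valuation.label, hids ids hl]
    congr 2
    exact funext fun j => j.elim0

theorem congr (h : Realizes R ρ H θ v n m) {θ' : Subst Sg.toCtorSig Name Sid}
    (hterms : ∀ p ∈ ρ.terms, p.subst θ' = p.subst θ)
    (hsess : ∀ s ∈ ρ.sess, s.subst θ'.sess = s.subst θ.sess)
    (hH : ∀ F ∈ H, F.subst θ' = F.subst θ) : Realizes R ρ H θ' v n m where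
  __ := h
  ord k hk := (hterms _ (List.getElem_mem hk)).trans (h.ord k hk)
  sess k hk := (hsess _ (List.getElem_mem hk)).trans (h.sess k hk)
  hyps F hF := hH F hF ▸ h.hyps F hF

theorem push (h : Realizes R ρ H θ v n m) {p q : Pattern Sg.toCtorSig Name Sid}
    (hp : p.subst θ = q) : Realizes R (ρ.push p) H θ (v.push q) (n + 1) m where
  __ := h
  length_terms := congrArg Nat.succ h.length_terms
  ord k hk := by
    cases k with
    | zero => exact hp
    | succ k => exact h.ord k (Nat.lt_of_succ_lt_succ hk)

theorem pushSess (h : Realizes R ρ H θ v n m) {s t : SessId Sid} (hs : s.subst θ.sess = t) :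
    Realizes R (ρ.pushSess s) H θ (v.pushSess t) n (m + 1) where
  __ := h
  length_sess := congrArg Nat.succ h.length_sess
  sess k hk := by
    cases k with
    | zero => exact hs
    | succ k => exact h.sess k (Nat.lt_of_succ_lt_succ hk)

theorem append (h : Realizes R ρ H θ v n m) {F : Fact Sg.toCtorSig Name Sid}
    (hF : Derivable R (F.subst θ)) : Realizes R ρ (H ++ [F]) θ v n m where
  __ := h
  hyps G hG := by
    rcases List.mem_append.1 hG with hG | hG
    · exact h.hyps G hG
    · rw [List.mem_singleton.1 hG]
      exact hF

/-- A substitution that factors through `σ` may have `σ` applied to `ρ` and `H` beforehand. -/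
theorem subst {σ δ : Subst Sg.toCtorSig Name Sid} (h : Realizes R ρ H (δ.comp σ) v n m) :
    Realizes R (ρ.subst σ) (H.map (Fact.subst σ)) δ v n m where
  length_terms := by simpa [TrEnv.subst] using h.length_terms
  length_sess := by simpa [TrEnv.subst] using h.length_sess
  name := h.name
  ord k hk := by
    simp only [TrEnv.subst, List.length_map] at hk
    simp only [TrEnv.subst, List.getElem_map, Pattern.subst_subst, h.ord k hk]
  sess k hk := by
    simp only [TrEnv.subst, List.length_map] at hk
    simp only [TrEnv.subst, List.getElem_map, SessId.subst_subst]
    exact h.sess k hk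
  hyps F hF := by
    obtain ⟨G, hG, rfl⟩ := List.mem_map.1 hF
    rw [Fact.subst_subst]
    exact h.hyps G hG

end Realizes

/-- Typability of the protocol. A substitution `θ` is carried along the translation: it extends to
a fresh variable at inputs and replications, and it factors through the most general unifiers at
tests and destructor applications, since the test succeeds on the instances by `θ`. -/
theorem IProc.typed_of_clausesOf_subset {D : Set Name} {P : IProc Sg Name Sid} :
    ∀ {ρ : TrEnv Sg.toCtorSig Name Sid} {H : List (Fact Sg.toCtorSig Name Sid)}
      {θ : Subst Sg.toCtorSig Name Sid} {v : Valuation Sg.toCtorSig Name Sid} {n m : ℕ},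
      clausesOf P ρ H ⊆ R → P.Within D n m → v.Ground n m → Realizes R ρ H θ v n m →
      P.Typed R v := by
  induction P with
  | output M N P ih =>
    intro ρ H θ v n m hR hw hg h
    refine ⟨?_, ih (fun cl hcl => hR (.inl hcl)) hw.2.2 hg h⟩
    refine .of_clause (hR (.inr rfl)) θ ?_
      (Fact.closed_message.2 ⟨hg.term hw.1, hg.term hw.2.1⟩) h.hyps
    simp only [Fact.subst, h.term hw.1, h.term hw.2.1]
  | input M P ih =>
    intro ρ H θ v n m hR hw hg h p hp
    obtain ⟨k, hk⟩ := ρ.exists_freshVar H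
    let θ' : Subst Sg.toCtorSig Name Sid := ⟨Function.update θ.ord k p, θ.sess⟩
    have hθ' : ∀ i, i ≠ k → θ'.ord i = θ.ord i := fun i hi => Function.update_of_ne hi _ _
    have h' : Realizes R ρ H θ' v n m := h.congr
      (fun q hq => Pattern.subst_congr
        (fun i hi => hθ' i (by rintro rfl; exact hk.1 q hq hi)) fun _ _ => rfl)
      (fun _ _ => rfl)
      (fun F hF => Fact.subst_congr
        (fun i hi => hθ' i (by rintro rfl; exact hk.2 F hF hi)) fun _ _ => rfl)
    have hvar : (Pattern.var k : Pattern Sg.toCtorSig Name Sid).subst θ' = p := by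
      simp [Pattern.subst, θ']
    refine ih (fun cl hcl => hR ⟨k, hk, hcl⟩) hw.2
      (hg.push (Fact.closed_message.1 hp.closed).2) ((h'.append ?_).push hvar)
    simpa only [Fact.subst, h'.term hw.1, hvar] using hp
  | nil => exact fun _ _ _ _ => trivial
  | par P Q ihP ihQ =>
    intro ρ H θ v n m hR hw hg h
    exact ⟨ihP (fun cl hcl => hR (.inl hcl)) hw.1 hg h,
      ihQ (fun cl hcl => hR (.inr hcl)) hw.2 hg h⟩
  | repl P ih =>
    intro ρ H θ v n m hR hw hg h l
    obtain ⟨k, hk⟩ := ρ.exists_freshSess H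
    let θ' : Subst Sg.toCtorSig Name Sid := ⟨θ.ord, Function.update θ.sess k (.const l)⟩
    have hθ' : ∀ i, i ≠ k → θ'.sess i = θ.sess i := fun i hi => Function.update_of_ne hi _ _
    have h' : Realizes R ρ H θ' v n m := h.congr
      (fun q hq => Pattern.subst_congr (fun _ _ => rfl)
        fun i hi => hθ' i (by rintro rfl; exact hk.1 q hq hi))
      (fun s hs => SessId.subst_congr
        fun i hi => hθ' i (by rintro rfl; exact hk.2.1 (hi ▸ hs)))
      (fun F hF => Fact.subst_congr (fun _ _ => rfl)
        fun i hi => hθ' i (by rintro rfl; exact hk.2.2 F hF hi))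
    exact ih (fun cl hcl => hR ⟨k, hk, hcl⟩) hw (hg.pushSess l)
      (h'.pushSess (by simp [SessId.subst, θ']))
  | res lab P ih =>
    intro ρ H θ v n m hR hw hg h
    exact ih hR hw.2 (hg.push (hg.label hw.1)) (h.push (h.label hw.1))
  | letDtor g Ms P Q ihP ihQ =>
    intro ρ H θ v n m hR hw hg h
    refine ⟨fun r hr τ hτ => ?_, ihQ (fun cl hcl => hR (.inr hcl)) hw.2.2 hg h⟩
    have heq : ∀ j, (ρ.term (Ms j)).subst θ = (r.lhs j).toPattern τ := fun j =>
      (h.term (hw.1 j)).trans (hτ j)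
    obtain ⟨σ, σ', hσ⟩ := exists_isMGPair heq
    obtain ⟨δ, rfl, hδ⟩ := hσ.2 θ τ heq
    obtain rfl : τ = fun k => (σ' k).subst δ := funext hδ
    exact ihP (fun cl hcl => hR (.inl ⟨r, hr, σ, σ', hσ, hcl⟩)) hw.2.1
      (hg.push (r.closed_rhs fun j => hτ j ▸ hg.term (hw.1 j)))
      (h.subst.push (r.rhs.toPattern_subst σ' δ))
  | cond M N P Q ihP ihQ =>
    intro ρ H θ v n m hR hw hg h
    refine ⟨fun hMN => ?_, ihQ (fun cl hcl => hR (.inr hcl)) hw.2.2.2 hg h⟩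
    have heq : (ρ.term M).subst θ = (ρ.term N).subst θ := by
      rw [h.term hw.1, h.term hw.2.1, hMN]
    obtain ⟨σ, hσ⟩ := exists_isMGU heq
    obtain ⟨δ, rfl⟩ := hσ.2 θ heq
    exact ihP (fun cl hcl => hR (.inl ⟨σ, hσ, hcl⟩)) hw.2.2.1 hg h.subst
  | event M P ih =>
    intro ρ H θ v n m hR hw hg h
    have hM := h.term hw.1
    refine ⟨.of_clause (hR (.inr rfl)) θ (congrArg Fact.event hM) (hg.term hw.1) h.hyps,
      fun hm => ih (fun cl hcl => hR (.inl hcl)) hw.2 hg (h.append ?_)⟩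
    simpa only [Fact.subst, hM] using hm

end Protocol

/-! ### Typability of the adversary -/

section Adversary

variable {Sg : Signature.{u, v}} {Name : Type w} {Sid : Type x} {Init : Finset Name}
  {R : Set (Clause Sg.toCtorSig Name Sid)}

theorem derivable_attacker_app (hR : {cl | AttackerClause Sg Sid Init cl} ⊆ R) {f : Sg.Ctor}
    (hf : Sg.ctorPublic f) {args : Fin (Sg.ctorArity f) → Pattern Sg.toCtorSig Name Sid}
    (h : ∀ j, Derivable R (.attacker (args j))) : Derivable R (.attacker (.app f args)) := by
  let σ : Subst Sg.toCtorSig Name Sid :=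
    ⟨fun k => if hk : k < Sg.ctorArity f then args ⟨k, hk⟩ else .var k, .var⟩
  have hσ : ∀ j : Fin (Sg.ctorArity f), (Pattern.var (j : ℕ)).subst σ = args j := fun j => by
    simp [Pattern.subst, σ]
  refine .of_clause (hR (.rf f hf)) σ ?_
    (Pattern.closed_app.2 fun j => (h j).closed) fun G hG => ?_
  · simp only [Fact.subst]
    rw [Pattern.subst]
    simp only [hσ]
  · obtain ⟨j, rfl⟩ := (List.mem_ofFn' _ _).1 hG
    simpa only [Fact.subst, hσ] using h j

theorem derivable_attacker_rhs (hR : {cl | AttackerClause Sg Sid Init cl} ⊆ R) {g : Sg.Dtor}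
    (hg : Sg.dtorPublic g) {r : RewriteRule Sg.toCtorSig (Sg.dtorArity g)}
    (hr : r ∈ Sg.rules g) {σ : ℕ → Pattern Sg.toCtorSig Name Sid}
    (h : ∀ j, Derivable R (.attacker ((r.lhs j).toPattern σ))) :
    Derivable R (.attacker (r.rhs.toPattern σ)) := by
  have hσ : ∀ t : RuleTerm Sg.toCtorSig,
      (t.toPattern Pattern.var).subst ⟨σ, SessId.var⟩ = t.toPattern σ := fun t =>
    t.toPattern_subst _ _
  refine .of_clause (hR (.rg g hg r hr)) ⟨σ, .var⟩ (congrArg Fact.attacker (hσ _))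
    (r.closed_rhs fun j => (h j).closed) fun G hG => ?_
  obtain ⟨j, rfl⟩ := (List.mem_ofFn' _ _).1 hG
  simpa only [Fact.subst, hσ] using h j

/-- The substitution of `p` and `q` for the variables `0` and `1`. -/
def Subst.pair {C : CtorSig.{u}} (p q : Pattern C Name Sid) : Subst C Name Sid :=
  ⟨fun | 0 => p | _ => q, .var⟩

theorem derivable_attacker_of_message (hR : {cl | AttackerClause Sg Sid Init cl} ⊆ R)
    {p q : Pattern Sg.toCtorSig Name Sid} (h : Derivable R (.message p q))
    (hp : Derivable R (.attacker p)) : Derivable R (.attacker q) := by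
  refine .of_clause (hR .rl) (.pair p q) rfl (Fact.closed_message.1 h.closed).2 fun G hG => ?_
  simp only [List.mem_cons, List.not_mem_nil, or_false] at hG
  rcases hG with rfl | rfl
  · exact h
  · exact hp

theorem derivable_message (hR : {cl | AttackerClause Sg Sid Init cl} ⊆ R)
    {p q : Pattern Sg.toCtorSig Name Sid} (hp : Derivable R (.attacker p))
    (hq : Derivable R (.attacker q)) : Derivable R (.message p q) := by
  refine .of_clause (hR .rs) (.pair p q) rfl (Fact.closed_message.2 ⟨hp.closed, hq.closed⟩)
    fun G hG => ?_
  simp only [List.mem_cons, List.not_mem_nil, or_false] at hG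
  rcases hG with rfl | rfl
  · exact hp
  · exact hq

theorem derivable_attacker_free (hR : {cl | AttackerClause Sg Sid Init cl} ⊆ R) {a : Name}
    (ha : a ∈ Init) : Derivable R (.attacker (.free a)) := by
  refine .of_clause (hR (.init a ha)) .id (congrArg Fact.attacker (Pattern.subst_id _))
    (Pattern.closed_free a) (by simp)

theorem derivable_attacker_bzero (hR : {cl | AttackerClause Sg Sid Init cl} ⊆ R)
    {p : Pattern Sg.toCtorSig Name Sid} (hp : p.Closed) :
    Derivable R (.attacker p.bzero) :=
  .of_clause (hR .rn) (.pair p p) rfl hp (by simp)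

/-- All that the adversary refers to is interpreted by patterns that the attacker has. -/
structure Valuation.Known (R : Set (Clause Sg.toCtorSig Name Sid)) (Init : Finset Name)
    (n m : ℕ) (v : Valuation Sg.toCtorSig Name Sid) : Prop where
  name : ∀ a ∈ Init, Derivable R (.attacker (v.name a))
  ord : ∀ k < n, Derivable R (.attacker (v.ord k))
  sess : ∀ k < m, (v.sess k).Within 0

namespace Valuation.Known

variable {n m : ℕ} {v : Valuation Sg.toCtorSig Name Sid}

theorem push (h : v.Known R Init n m) {p : Pattern Sg.toCtorSig Name Sid}
    (hp : Derivable R (.attacker p)) : (v.push p).Known R Init (n + 1) m := by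
  refine ⟨h.name, fun k hk => ?_, h.sess⟩
  cases k with
  | zero => exact hp
  | succ k => exact h.ord k (Nat.lt_of_succ_lt_succ hk)

theorem pushSess (h : v.Known R Init n m) (l : Sid) :
    (v.pushSess (.const l)).Known R Init n (m + 1) := by
  refine ⟨h.name, h.ord, fun k hk => ?_⟩
  cases k with
  | zero => trivial
  | succ k => exact h.sess k (Nat.lt_of_succ_lt_succ hk)

theorem term (h : v.Known R Init n m) (hR : {cl | AttackerClause Sg Sid Init cl} ⊆ R)
    {M : Term Sg.toCtorSig Name} (hM : M.Within (Init : Set Name) n) (hpub : M.PublicOnly) :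
    Derivable R (.attacker (v.term M)) := by
  induction M with
  | bound k => exact h.ord k hM
  | name a => exact h.name a hM
  | app f args ih =>
    exact derivable_attacker_app hR hpub.1 fun j => ih j (hM j) (hpub.2 j)

end Valuation.Known

theorem Proc.typed_instrAdvAux (hR : {cl | AttackerClause Sg Sid Init cl} ⊆ R)
    {Q : Proc Sg Name} : ∀ {s : List ℕ} {n m : ℕ} {v : Valuation Sg.toCtorSig Name Sid},
    (instrAdvAux Sid s Q).Within (Init : Set Name) n m → Q.NoEvents → Q.PublicOnly →
    v.Known R Init n m → (instrAdvAux Sid s Q).Typed R v := by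
  induction Q with
  | output M N P ih =>
    intro s n m v hw he hp h
    exact ⟨derivable_message hR (h.term hR hw.1 hp.1) (h.term hR hw.2.1 hp.2.1),
      ih hw.2.2 he hp.2.2 h⟩
  | input M P ih =>
    intro s n m v hw he hp h p hmsg
    exact ih hw.2 he hp.2
      (h.push (derivable_attacker_of_message hR hmsg (h.term hR hw.1 hp.1)))
  | nil => exact fun _ _ _ _ => trivial
  | par P Q ihP ihQ =>
    intro s n m v hw he hp h
    exact ⟨ihP hw.1 he.1 hp.1 h, ihQ hw.2 he.2 hp.2 h⟩
  | repl P ih =>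
    intro s n m v hw he hp h l
    exact ih hw he hp (h.pushSess l)
  | res a P ih =>
    intro s n m v hw he hp h
    refine ih hw.2 he hp (h.push (derivable_attacker_bzero hR ?_))
    refine .name (fun j => j.elim0) fun i hi => ?_
    obtain ⟨i', hi', rfl⟩ := List.mem_map.1 hi
    have := hw.1 i' hi'
    cases i' with
    | var k => exact h.sess k this
    | const l => trivial
  | letDtor g Ms P Q ihP ihQ =>
    intro s n m v hw he hp h
    refine ⟨fun r hr σ hσ => ?_, ihQ hw.2.2 he.2 hp.2.2.2 h⟩
    exact ihP hw.2.1 he.1 hp.2.2.1 (h.push (derivable_attacker_rhs hR hp.1 hr fun j =>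
      hσ j ▸ h.term hR (hw.1 j) (hp.2.1 j)))
  | cond M N P Q ihP ihQ =>
    intro s n m v hw he hp h
    exact ⟨fun _ => ihP hw.2.2.1 he.1 hp.2.2.1 h, ihQ hw.2.2.2 he.2 hp.2.2.2 h⟩
  | event M P ih => exact fun _ he => he.elim

end Adversary

/-! ### Subject reduction -/

section SubjectReduction

variable {Sg : Signature.{u, v}} {Name : Type w} {Sid : Type x}
  {R : Set (Clause Sg.toCtorSig Name Sid)}

/-- The invariant of the processes `P` of a configuration with environment `E`: `P` is closed,
its free names are in the domain of `E`, and it is well-typed. -/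
structure Env.Accepts (R : Set (Clause Sg.toCtorSig Name Sid)) (E : Env Sg.toCtorSig Name Sid)
    (P : IProc Sg Name Sid) : Prop where
  within : P.Within E.dom 0 0
  typed : P.Typed R E.valuation

/-- `E'` extends `E`. -/
structure Env.Le {C : CtorSig.{u}} (E E' : Env C Name Sid) : Prop where
  dom : E.dom ⊆ E'.dom
  map : ∀ a ∈ E.dom, E.map a = E'.map a

theorem Env.Le.rfl {C : CtorSig.{u}} {E : Env C Name Sid} : E.Le E :=
  ⟨subset_rfl, fun _ _ => _root_.rfl⟩

theorem Env.Le.trans {C : CtorSig.{u}} {E E' E'' : Env C Name Sid} (h : E.Le E')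
    (h' : E'.Le E'') : E.Le E'' :=
  ⟨h.dom.trans h'.dom, fun a ha => (h.map a ha).trans (h'.map a (h.dom ha))⟩

theorem Env.Le.agree {C : CtorSig.{u}} {E E' : Env C Name Sid} (h : E.Le E') :
    E.valuation.Agree E.dom 0 0 E'.valuation :=
  ⟨h.map, fun _ _ => _root_.rfl, fun _ _ => _root_.rfl⟩

theorem Env.Le.term {C : CtorSig.{u}} {E E' : Env C Name Sid} (h : E.Le E')
    {M : Term C Name} (hM : M.Within E.dom 0) : E.term M = E'.term M := by
  rw [← E.valuation_term, ← E'.valuation_term]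
  exact h.agree.term hM

theorem Env.Le.accepts {E E' : Env Sg.toCtorSig Name Sid} (h : E.Le E')
    {P : IProc Sg Name Sid} (hP : E.Accepts R P) : E'.Accepts R P :=
  ⟨hP.within.mono h.dom, hP.typed.congr h.agree hP.within⟩

theorem Env.le_extend {C : CtorSig.{u}} (E : Env C Name Sid) {a : Name} (ha : a ∉ E.dom)
    (p : Pattern C Name Sid) : E.Le (E.extend a p) :=
  ⟨Set.subset_insert _ _, fun b hb => by
    have hba : b ≠ a := by
      rintro rfl
      exact ha hb
    simp [Env.extend, hba]⟩

theorem Step.env_le {c c' : Config Sg Name Sid} (h : Step c c') : c.env.Le c'.env := by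
  cases h with
  | res S E Ps lab P a ha => exact E.le_extend ha _
  | _ => exact .rfl

/-- A binder is opened: the index that goes out of scope is dropped from the valuation. -/
theorem Env.accepts_openTerm {E : Env Sg.toCtorSig Name Sid} {P : IProc Sg Name Sid}
    {M : Term Sg.toCtorSig Name} {p : Pattern Sg.toCtorSig Name Sid}
    (hM : M.Within E.dom 0) (hp : E.valuation.term M = p) (hw : P.Within E.dom 1 0)
    (hP : P.Typed R (E.valuation.push p)) : E.Accepts R (P.openTerm M 0) := by
  refine ⟨hw.openTerm hM, ?_⟩
  have hMv : ∀ v : Valuation Sg.toCtorSig Name Sid, v.name = E.map → v.term M = p := by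
    intro v hv
    rw [← hp]
    exact Valuation.Agree.term (D := E.dom) (n := 0) (m := 0)
      ⟨fun a _ => congrFun hv a, by simp, by simp⟩ hM
  have hopen := hP.openTerm (k := 0) hMv rfl rfl
  refine hopen.congr (D := E.dom) (n := 0) (m := 0) ?_ (hw.openTerm hM)
  exact ⟨fun _ _ => rfl, by simp, by simp⟩

/-- Subject reduction. Since the rule of events in `IProc.Typed` assumes that the event is
granted, this is required of the events that the step executes. -/
theorem Step.accepts {c c' : Config Sg Name Sid} (h : Step c c')
    (hc : ∀ P ∈ c.procs, c.env.Accepts R P)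
    (hevent : ∀ S E Ps M P, c = ⟨S, E, .event M P ::ₘ Ps⟩ → c' = ⟨S, E, P ::ₘ Ps⟩ →
      Derivable R (.mevent (E.term M))) :
    ∀ P ∈ c'.procs, c'.env.Accepts R P := by
  cases h with
  | nil S E Ps => exact (Multiset.forall_mem_cons.1 hc).2
  | repl S E Ps P l hl =>
    have hP := (Multiset.forall_mem_cons.1 hc).1
    refine Multiset.forall_mem_cons.2 ⟨⟨hP.within.openSess, ?_⟩, hc⟩
    have hopen := (hP.typed l).openSess (l := l) (k := 0) rfl
    refine hopen.congr (D := E.dom) (n := 0) (m := 0) ?_ hP.within.openSess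
    exact ⟨fun _ _ => rfl, by simp, by simp⟩
  | par S E Ps P Q =>
    obtain ⟨hP, hPs⟩ := Multiset.forall_mem_cons.1 hc
    exact Multiset.forall_mem_cons.2 ⟨⟨hP.within.1, hP.typed.1⟩,
      Multiset.forall_mem_cons.2 ⟨⟨hP.within.2, hP.typed.2⟩, hPs⟩⟩
  | res S E Ps lab P a ha =>
    obtain ⟨hP, hPs⟩ := Multiset.forall_mem_cons.1 hc
    have hle := E.le_extend ha (E.label lab)
    refine Multiset.forall_mem_cons.2 ⟨?_, fun Q hQ => hle.accepts (hPs Q hQ)⟩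
    refine Env.accepts_openTerm (p := E.label lab) (Set.mem_insert _ _)
      (by simp [Env.valuation, Valuation.term, Env.extend]) (hP.within.2.mono hle.dom) ?_
    have h := hP.typed
    unfold IProc.Typed at h
    rw [E.valuation_label] at h
    exact h.congr (hle.agree.push _) hP.within.2
  | comm S E Ps N M Q P =>
    obtain ⟨hO, hc⟩ := Multiset.forall_mem_cons.1 hc
    obtain ⟨hI, hPs⟩ := Multiset.forall_mem_cons.1 hc
    exact Multiset.forall_mem_cons.2 ⟨⟨hO.within.2.2, hO.typed.2⟩, Multiset.forall_mem_cons.2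
      ⟨Env.accepts_openTerm hO.within.2.1 rfl hI.within.2 (hI.typed _ hO.typed.1), hPs⟩⟩
  | dtorThen S E Ps g Ms P Q M h =>
    obtain ⟨hP, hPs⟩ := Multiset.forall_mem_cons.1 hc
    refine Multiset.forall_mem_cons.2 ⟨?_, hPs⟩
    have hM := h.within hP.within.1
    obtain ⟨r, hr, σ, hlhs, rfl⟩ := h
    refine Env.accepts_openTerm hM (Valuation.term_toTerm σ r.rhs) hP.within.2.1
      (hP.typed.1 r hr _ fun j => ?_)
    rw [hlhs j, Valuation.term_toTerm]
  | dtorElse S E Ps g Ms P Q h =>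
    obtain ⟨hP, hPs⟩ := Multiset.forall_mem_cons.1 hc
    exact Multiset.forall_mem_cons.2 ⟨⟨hP.within.2.2, hP.typed.2⟩, hPs⟩
  | condThen S E Ps M P Q =>
    obtain ⟨hP, hPs⟩ := Multiset.forall_mem_cons.1 hc
    exact Multiset.forall_mem_cons.2 ⟨⟨hP.within.2.2.1, hP.typed.1 rfl⟩, hPs⟩
  | condElse S E Ps M N P Q h =>
    obtain ⟨hP, hPs⟩ := Multiset.forall_mem_cons.1 hc
    exact Multiset.forall_mem_cons.2 ⟨⟨hP.within.2.2.2, hP.typed.2⟩, hPs⟩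
  | event S E Ps M P =>
    obtain ⟨hP, hPs⟩ := Multiset.forall_mem_cons.1 hc
    refine Multiset.forall_mem_cons.2 ⟨⟨hP.within.2, hP.typed.2 ?_⟩, hPs⟩
    rw [E.valuation_term]
    exact hevent S E Ps M P rfl rfl

theorem Trace.env_le_last (T : Trace Sg Name Sid) (j : Fin (T.length + 1)) :
    (T.config j).env.Le T.last.env := by
  induction j using Fin.reverseInduction with
  | last => exact .rfl
  | cast j ih => exact (T.step j).env_le.trans ih

/-- All facts that a trace of well-typed processes satisfies are derivable. -/
theorem Trace.derivable_of_satisfies {Init : Finset Name}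
    (hR : {cl | AttackerClause Sg Sid Init cl} ⊆ R) (T : Trace Sg Name Sid)
    (hfirst : ∀ P ∈ T.first.procs, T.first.env.Accepts R P)
    (hInit : ∀ a ∈ Init, a ∈ T.first.env.dom ∧ T.first.env.map a = .free a)
    (hevent : ∀ p, T.Satisfies Init (.event p) → Derivable R (.mevent p))
    {F : Fact Sg.toCtorSig Name Sid} (hF : T.Satisfies Init F) : Derivable R F := by
  have hacc : ∀ j, ∀ P ∈ (T.config j).procs, (T.config j).env.Accepts R P := by
    intro j
    induction j using Fin.induction with
    | zero => exact hfirst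
    | succ j ih =>
      refine (T.step j).accepts ih fun S E Ps M P h h' => hevent _ ⟨.event M, ?_, ?_⟩
      · exact ⟨j, S, E, Ps, P, h, h'⟩
      · have hle := T.env_le_last j.castSucc
        rw [h] at hle ih
        have hM := (Multiset.forall_mem_cons.1 ih).1.within.1
        exact congrArg Fact.event (hle.term hM).symm
  have hsends : ∀ M N, T.Sends M N →
      Derivable R (.message (T.last.env.term M) (T.last.env.term N)) := by
    rintro M N ⟨j, S, E, Ps, P, Q, h, -⟩
    have hle := T.env_le_last j.castSucc
    have hj := hacc j.castSucc
    rw [h] at hle hj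
    have hO := (Multiset.forall_mem_cons.1 hj).1
    rw [← hle.term hO.within.1, ← hle.term hO.within.2.1, ← E.valuation_term,
      ← E.valuation_term]
    exact hO.typed.1
  obtain ⟨α, hα, rfl⟩ := hF
  cases α with
  | attacker M =>
    obtain ⟨c, hc, hcM⟩ := hα
    refine derivable_attacker_of_message hR (hsends _ _ hcM) ?_
    obtain ⟨hdom, hmap⟩ := hInit c hc
    have := (T.env_le_last 0).map c hdom
    rw [Env.term, ← this, ← Trace.first, hmap]
    exact derivable_attacker_free hR hc
  | message M N => exact hsends M N hα
  | event M =>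
    obtain ⟨j, S, E, Ps, P, h, -⟩ := hα
    have hle := T.env_le_last j.castSucc
    have hj := hacc j.castSucc
    rw [h] at hle hj
    have hP := (Multiset.forall_mem_cons.1 hj).1
    rw [Env.atom, ← hle.term hP.within.1, ← E.valuation_term]
    exact hP.typed.1

end SubjectReduction

end Corr

open Corr

theorem mainTheorem2
    {Sg : Corr.Signature.{u, v}} {Name : Type w} {Sid : Type x}
    (Init : Finset Name)
    (P₀ Q : Corr.Proc Sg Name)
    (hP₀ : P₀.Closed)
    (hQ : Corr.IsAdversary Init Q)
    (T : Corr.Trace Sg Name Sid)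
    (S₀ : Set Sid) (hS₀ : S₀.Countable)
    (E₀ : Corr.Env Sg.toCtorSig Name Sid)
    (hT : T.first = ⟨S₀, E₀, {P₀.instr Sid, Q.instrAdv Sid}⟩)
    (hdom : (P₀.instr Sid).fn ∪ (Init : Set Name) ⊆ E₀.dom)
    (hE₀ : ∀ a ∈ E₀.dom, E₀.map a = Corr.Pattern.free a)
    (Fme : Set (Corr.Fact Sg.toCtorSig Name Sid))
    (hFme : ∀ F ∈ Fme, F.Closed ∧ ∃ p, F = Corr.Fact.mevent p)
    (hevent : ∀ p, T.Satisfies Init (.event p) → Corr.Fact.mevent p ∈ Fme)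
    (F : Corr.Fact Sg.toCtorSig Name Sid)
    (hF : T.Satisfies Init F) :
    Corr.Derivable
      (Corr.protocolClauses (P₀.instr Sid) Init ∪ Corr.factClauses Fme) F := by
  have hdomP : (P₀.instr Sid).fn ⊆ E₀.dom := Set.subset_union_left.trans hdom
  have hdomI : (Init : Set Name) ⊆ E₀.dom := Set.subset_union_right.trans hdom
  have hR : {cl | AttackerClause Sg Sid Init cl} ⊆
      protocolClauses (P₀.instr Sid) Init ∪ factClauses Fme := fun cl hcl => .inl (.inr hcl)
  have hPw : (P₀.instr Sid).Within E₀.dom 0 0 :=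
    Proc.within_instrAux hP₀ hdomP (by simp) (by simp)
  have hQw : (Q.instrAdv Sid).Within (Init : Set Name) 0 0 :=
    Proc.within_instrAdvAux hQ.closed hQ.fn_subset (by simp)
  have hPt : (P₀.instr Sid).Typed (protocolClauses (P₀.instr Sid) Init ∪ factClauses Fme)
      ⟨.free, .var, .var⟩ :=
    IProc.typed_of_clausesOf_subset (ρ := ⟨[], []⟩) (H := []) (θ := .id)
      (fun cl hcl => .inl (.inl hcl)) hPw ⟨Pattern.closed_free, by simp, by simp⟩
      ⟨rfl, rfl, fun _ => rfl, fun k hk => absurd hk (Nat.not_lt_zero k),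
        fun k hk => absurd hk (Nat.not_lt_zero k), by simp⟩
  refine T.derivable_of_satisfies hR ?_ ?_ (fun p hp => ?_) hF
  · rw [hT]
    change ∀ P ∈ P₀.instr Sid ::ₘ {Q.instrAdv Sid}, E₀.Accepts _ P
    refine Multiset.forall_mem_cons.2 ⟨?_, fun P hP => ?_⟩
    · refine ⟨hPw, hPt.congr ?_ hPw⟩
      exact ⟨fun a ha => (hE₀ a ha).symm, fun _ _ => rfl, fun _ _ => rfl⟩
    · rw [Multiset.mem_singleton.1 hP]
      refine ⟨hQw.mono hdomI, Proc.typed_instrAdvAux hR hQw hQ.noEvents hQ.publicOnly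
        ⟨fun a ha => ?_, by simp, by simp⟩⟩
      have : E₀.valuation.name a = .free a := hE₀ a (hdomI ha)
      rw [this]
      exact derivable_attacker_free hR ha
  · rw [hT]
    exact fun a ha => ⟨hdomI ha, hE₀ a (hdomI ha)⟩
  · have hmem := hevent p hp
    exact .of_clause (cl := ⟨[], .mevent p⟩) (.inr ⟨rfl, hmem⟩) .id
      (congrArg Fact.mevent p.subst_id) (hFme _ hmem).1 (by simp)
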